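/- For a finite group $G$ and a subset $S\subseteq G$, let $\mathrm{Cay}(G,S)$ be the digraph with vertex set $G$ in which $(x,y)$ is an arc if and only if $yx^{-1}\in S$. We say that $G$ admits an oriented regular representation (ORR) if there is a subset $S\subseteq G$ with $S\cap S^{-1}=\emptyset$ such that the automorphism group of $\mathrm{Cay}(G,S)$ is exactly the group of right translations $x\mapsto xa$ ($a\in G$). Let $G$ be a finite group, $N$ a normal subgroup of $G$, $g\in G$ and $n_0\in N$ such that - $|G:N|=2$, $N$ is a $2$-group, $G=\langle N,g\rangle$ and $g^2=1$; - with $H:=\{n\in N : g^{-1}ng=n^{-1}\}$, we have $|H|=|N|/2$ and $N=H\cup n_0H$; - no automorphism of $N$ inverts more than half of the elements of $N$. Then $G$ admits an ORR, except possibly if $N$ has an abelian subgroup $A$ with $|N:A|=4$ such that either $A\cong C_4\times C_2^{\ell}$ for some integer $0\le \ell\le 5$, or $A$ is an elementary abelian $2$-group of rank at most $7$. -/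

import Mathlib

open scoped Pointwise

/-- The automorphism group of a digraph, as a subgroup of the symmetric group on its vertices:
the permutations `φ` such that `(x, y)` is an arc if and only if `(φ x, φ y)` is an arc. -/
def Digraph.autGroup {V : Type*} (Γ : Digraph V) : Subgroup (Equiv.Perm V) where
  carrier := {φ | ∀ x y : V, Γ.Adj (φ x) (φ y) ↔ Γ.Adj x y}
  mul_mem' := by
    intro φ ψ hφ hψ x y
    exact (hφ (ψ x) (ψ y)).trans (hψ x y)
  one_mem' := fun _ _ => Iff.rfl
  inv_mem' := by
    intro φ hφ x y
    have h := hφ (φ.symm x) (φ.symm y)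
    rw [Equiv.apply_symm_apply, Equiv.apply_symm_apply] at h
    exact h.symm

/-- The Cayley digraph `Cay(G, S)`: `(x, y)` is an arc if and only if `y * x⁻¹ ∈ S`. -/
def cayleyDigraph (G : Type*) [Group G] (S : Set G) : Digraph G where
  Adj x y := y * x⁻¹ ∈ S

/-- The image of the right regular representation of `G`: the group of all right translations
`x ↦ x * a` with `a ∈ G`. -/
def rightRegular (G : Type*) [Group G] : Subgroup (Equiv.Perm G) :=
  (MulAction.toPermHom Gᵐᵒᵖ G).range

/-- `G` admits an oriented regular representation (ORR): there is a subset `S` of `G` with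
`S ∩ S⁻¹ = ∅` such that the automorphism group of `Cay(G, S)` is `G` (acting on itself by
right translations). -/
def AdmitsORR (G : Type*) [Group G] : Prop :=
  ∃ S : Set G, S ∩ S⁻¹ = ∅ ∧ (cayleyDigraph G S).autGroup = rightRegular G

/-- The set of those elements `n` of `N` with `n ^ g = n⁻¹`, where `n ^ g = g⁻¹ * n * g`. -/
def invertedBy {G : Type*} [Group G] (N : Subgroup G) (g : G) : Set G :=
  {n | n ∈ N ∧ g⁻¹ * n * g = n⁻¹}

/-- The group `C₄ × C₂ ^ ℓ`, written multiplicatively. -/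
abbrev C4TimesC2Pow (ℓ : ℕ) : Type :=
  Multiplicative (ZMod 4 × (Fin ℓ → ZMod 2))

/-- The elementary abelian `2`-group `C₂ ^ r` of rank `r`, written multiplicatively. -/
abbrev C2Pow (r : ℕ) : Type :=
  Multiplicative (Fin r → ZMod 2)

/-! The group `G` is a finite 2-group, and `charVec` records an element modulo the Frattini subgroup
as a vector over the field with two elements. Call an element a non-involution if its square is not
1. The connection set comes from a path: non-involutions x_0, ..., x_{k-1}, independent modulo the
Frattini subgroup, whose quotients x_{i+1} x_i⁻¹ are non-involutions too. Let S consist of these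
vertices and quotients, plus possibly one further isolated vertex so that S generates G. Distinct
elements of S have distinct character vectors while s and s⁻¹ share theirs, so S ∩ S⁻¹ is empty.

An automorphism fixing 1 preserves the digraph induced on S. That digraph contains the arcs x_i →
x_{i+1}; every other arc encodes one of three special relations between two consecutive vertices
(`IsPath.arc_iff`). Middle points of induced directed 2-paths are vertices, so inner vertices are
fixed (`IsPath.vertex_mem_fixer`). If x_0 and x_1 do not commute, the end vertices are fixed as
well: always for k ≥ 4, and for k = 2, 3 outside explicit quaternion-like configurations. The common
fixed points of the stabilizer of 1 form a subgroup (`fixer`), so fixing generators is enough.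

It remains to find such a path whose span has codimension at most one. A noncommuting edge is
extended greedily. When this is blocked at an edge a, b, every non-involution p outside the current
span forms an `AntiPair` with a, b and b a⁻¹, which forces p² to be one element z independent of p
(`AntiPair.sq_eq`). Then all squares of G lie in {1, z}. This is impossible already in N, by
averaging over automorphisms n ↦ n c(n) with c a homomorphism into {1, z}
(`manySquares_of_inverting`).

The starting edge comes from H: all g n₀ t with t ∈ H are non-involutions. Without an edge N would
have an abelian subgroup of index at most two (`InvertsHalf.exists_edge`), hence an automorphism
inverting more than half of N (`false_of_abelian_index_le_two`). If all edges commuted, G would be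
abelian (`exists_noncommuting_start`). -/

/-! ### Coordinates modulo the Frattini subgroup. -/

section CharVec

variable {G : Type*} [Group G]

/-- The vector of the values at `g` of all homomorphisms from `G` to the group of order two. -/
def charVec (g : G) : (G →* Multiplicative (ZMod 2)) → ZMod 2 :=
  fun χ => (χ g).toAdd

@[simp] theorem charVec_mul (a b : G) : charVec (a * b) = charVec a + charVec b := by
  ext χ; simp [charVec]

@[simp] theorem charVec_one : charVec (1 : G) = 0 := by
  ext χ; simp [charVec]

theorem zmod_two_neg {V : Type*} [AddCommGroup V] [Module (ZMod 2) V] (v : V) : -v = v := by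
  rw [neg_eq_iff_add_eq_zero, ← two_smul (ZMod 2) v]
  have : (2 : ZMod 2) = 0 := by decide
  rw [this, zero_smul]

theorem zmod_two_add_self {V : Type*} [AddCommGroup V] [Module (ZMod 2) V] (v : V) :
    v + v = 0 := by
  rw [← neg_eq_iff_add_eq_zero, zmod_two_neg]

@[simp] theorem charVec_inv (a : G) : charVec a⁻¹ = charVec a := by
  have h : charVec a⁻¹ + charVec a = 0 := by rw [← charVec_mul]; simp
  rw [← zmod_two_neg (charVec a)]
  exact eq_neg_of_add_eq_zero_left h

/-- The preimage of a subspace under `charVec`. -/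
def charPreimage (W : Submodule (ZMod 2) ((G →* Multiplicative (ZMod 2)) → ZMod 2)) :
    Subgroup G where
  carrier := {g | charVec g ∈ W}
  mul_mem' := by
    intro a b ha hb
    simpa using W.add_mem ha hb
  one_mem' := by simp
  inv_mem' := by
    intro a ha
    simpa using ha

@[simp] theorem mem_charPreimage
    {W : Submodule (ZMod 2) ((G →* Multiplicative (ZMod 2)) → ZMod 2)} {g : G} :
    g ∈ charPreimage W ↔ charVec g ∈ W := Iff.rfl

open Classical in
/-- The homomorphism onto the group of order two with a given kernel of index two. -/
noncomputable def charOfIndexTwo (K : Subgroup G) (hK : K.index = 2) :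
    G →* Multiplicative (ZMod 2) where
  toFun g := if g ∈ K then 1 else Multiplicative.ofAdd 1
  map_one' := by simp [K.one_mem]
  map_mul' := by
    intro a b
    have h := Subgroup.mul_mem_iff_of_index_two hK (a := a) (b := b)
    by_cases ha : a ∈ K <;> by_cases hb : b ∈ K <;> simp [h, ha, hb]
    decide

theorem charOfIndexTwo_eq_zero_iff (K : Subgroup G) (hK : K.index = 2) (g : G) :
    charVec g (charOfIndexTwo K hK) = 0 ↔ g ∈ K := by
  by_cases h : g ∈ K <;> simp [charVec, charOfIndexTwo, h]

theorem exists_index_two_of_ne_top [Finite G] (hG : IsPGroup 2 G) {C : Subgroup G}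
    (hC : C ≠ ⊤) : ∃ K : Subgroup G, K.index = 2 ∧ C ≤ K := by
  have : Fact (Nat.Prime 2) := ⟨Nat.prime_two⟩
  obtain ⟨n, hn⟩ := IsPGroup.iff_card.mp hG
  obtain ⟨m, hm⟩ := IsPGroup.iff_card.mp (hG.to_subgroup C)
  have hlt : Nat.card C < Nat.card G := by
    refine lt_of_le_of_ne (Nat.card_le_card_of_injective _ C.subtype_injective) ?_
    intro h
    exact hC ((Subgroup.card_eq_iff_eq_top C).mp h)
  have hmn : m < n := by
    rw [hn, hm] at hlt
    exact (Nat.pow_lt_pow_iff_right (by norm_num)).mp hlt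
  obtain ⟨K, hK, hCK⟩ := Sylow.exists_subgroup_card_pow_prime_le 2 (n := m) (m := n - 1)
    (hn ▸ pow_dvd_pow 2 (Nat.sub_le n 1)) C hm (by omega)
  refine ⟨K, ?_, hCK⟩
  have h := K.index_mul_card
  rw [hK, hn] at h
  have h2 : 2 ^ n = 2 * 2 ^ (n - 1) := by
    rw [← pow_succ']; congr 1; omega
  rw [h2] at h
  exact Nat.eq_of_mul_eq_mul_right (by positivity) h

/-- A subset of a finite `2`-group whose character vectors span generates the group. -/
theorem closure_eq_top_of_charVec [Finite G] (hG : IsPGroup 2 G) (X : Set G)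
    (h : ∀ g : G, charVec g ∈ Submodule.span (ZMod 2) (charVec '' X)) :
    Subgroup.closure X = ⊤ := by
  by_contra hC
  -- Burnside's basis theorem: a proper subgroup lies in one of index two, the kernel of a
  -- character, and that coordinate of `charVec` vanishes on the whole span.
  obtain ⟨K, hK, hCK⟩ := exists_index_two_of_ne_top hG hC
  have hle : Submodule.span (ZMod 2) (charVec '' X) ≤
      LinearMap.ker (LinearMap.proj (R := ZMod 2) (φ := fun _ => ZMod 2)
        (charOfIndexTwo K hK)) := by
    rw [Submodule.span_le]
    rintro _ ⟨x, hx, rfl⟩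
    simp only [SetLike.mem_coe, LinearMap.mem_ker, LinearMap.proj_apply]
    exact (charOfIndexTwo_eq_zero_iff K hK x).mpr (hCK (Subgroup.subset_closure hx))
  have : K = ⊤ := by
    rw [eq_top_iff]
    intro g _
    have := hle (h g)
    simp only [LinearMap.mem_ker, LinearMap.proj_apply] at this
    exact (charOfIndexTwo_eq_zero_iff K hK g).mp this
  rw [this, Subgroup.index_top] at hK
  omega

end CharVec

/-! ### Linear algebra over the field with two elements. -/

section LinearAlgebra

variable {V : Type*} [AddCommGroup V] [Module (ZMod 2) V]

theorem zmod_two_eq_zero_or_one (c : ZMod 2) : c = 0 ∨ c = 1 := by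
  revert c; decide

theorem zmod_two_mem_span_singleton {a v : V} :
    v ∈ Submodule.span (ZMod 2) {a} ↔ v = 0 ∨ v = a := by
  rw [Submodule.mem_span_singleton]
  constructor
  · rintro ⟨c, rfl⟩
    rcases zmod_two_eq_zero_or_one c with rfl | rfl <;> simp
  · rintro (rfl | rfl)
    · exact ⟨0, by simp⟩
    · exact ⟨1, by simp⟩

theorem zmod_two_mem_sup_span {W : Submodule (ZMod 2) V} {a v : V} :
    v ∈ W ⊔ Submodule.span (ZMod 2) {a} ↔ v ∈ W ∨ v + a ∈ W := by
  rw [Submodule.mem_sup]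
  constructor
  · rintro ⟨w, hw, b, hb, rfl⟩
    rcases zmod_two_mem_span_singleton.mp hb with rfl | rfl
    · left; simpa using hw
    · right; rw [add_assoc, zmod_two_add_self, add_zero]; exact hw
  · rintro (h | h)
    · exact ⟨v, h, 0, zero_mem _, add_zero v⟩
    · exact ⟨v + a, h, a, Submodule.mem_span_singleton_self a, by
        rw [add_assoc, zmod_two_add_self, add_zero]⟩

theorem zmod_two_mem_span_pair {a b v : V} :
    v ∈ Submodule.span (ZMod 2) {a, b} ↔ v = 0 ∨ v = a ∨ v = b ∨ v = a + b := by
  have h : Submodule.span (ZMod 2) {a, b} =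
      Submodule.span (ZMod 2) {a} ⊔ Submodule.span (ZMod 2) {b} := by
    rw [← Submodule.span_union]; rfl
  rw [h, zmod_two_mem_sup_span, zmod_two_mem_span_singleton, zmod_two_mem_span_singleton]
  have e1 : v + b = 0 ↔ v = b := by rw [add_eq_zero_iff_eq_neg, zmod_two_neg]
  have e2 : v + b = a ↔ v = a + b := by
    rw [← eq_sub_iff_add_eq, sub_eq_add_neg, zmod_two_neg]
  rw [e1, e2]
  tauto

/-- A sequence each of whose terms lies outside the span of the previous ones has a dual family. -/
theorem exists_dual_family (v : ℕ → V) (k : ℕ)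
    (h : ∀ i < k, v i ∉ Submodule.span (ZMod 2) (v '' Set.Iio i)) :
    ∃ f : ℕ → V →ₗ[ZMod 2] ZMod 2, ∀ i < k, ∀ j < k, f i (v j) = if i = j then 1 else 0 := by
  induction k with
  | zero => exact ⟨fun _ => 0, fun i hi => absurd hi (Nat.not_lt_zero i)⟩
  | succ k ih =>
    obtain ⟨f, hf⟩ := ih fun i hi => h i (Nat.lt_succ_of_lt hi)
    obtain ⟨φ, hφ, hker⟩ := Submodule.exists_le_ker_of_notMem (h k (Nat.lt_succ_self k))
    have hφ1 : φ (v k) = 1 := (zmod_two_eq_zero_or_one _).resolve_left hφ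
    have hφ0 : ∀ j < k, φ (v j) = 0 := fun j hj =>
      hker (Submodule.subset_span ⟨j, hj, rfl⟩)
    -- Subtracting a multiple of `φ` kills the value at the new vector and leaves the values at
    -- earlier ones alone.
    refine ⟨fun i => if i = k then φ else f i - f i (v k) • φ, ?_⟩
    intro i hi j hj
    rcases Nat.lt_succ_iff_lt_or_eq.mp hi with hi' | rfl
    · rcases Nat.lt_succ_iff_lt_or_eq.mp hj with hj' | rfl
      · simp [hi'.ne, hφ0 j hj', hf i hi' j hj']
      · simp [hi'.ne, hφ1]
    · rcases Nat.lt_succ_iff_lt_or_eq.mp hj with hj' | rfl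
      · simp [hj'.ne', hφ0 j hj']
      · simp [hφ1]

end LinearAlgebra

/-! ### Automorphisms of a Cayley digraph fixing the identity. -/

section Fixer

variable {G : Type*} [Group G]

theorem mem_autGroup_cayleyDigraph {S : Set G} {φ : Equiv.Perm G} :
    φ ∈ (cayleyDigraph G S).autGroup ↔ ∀ x y : G, φ y * (φ x)⁻¹ ∈ S ↔ y * x⁻¹ ∈ S := Iff.rfl

theorem mulRight_mem_autGroup (S : Set G) (a : G) :
    Equiv.mulRight a ∈ (cayleyDigraph G S).autGroup := by
  rw [mem_autGroup_cayleyDigraph]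
  intro x y
  simp [mul_assoc]

/-- The subgroup of elements fixed by all automorphisms of `Cay(G, S)` that fix the identity. -/
def fixer [Finite G] (S : Set G) : Subgroup G :=
  subgroupOfFiniteSubmonoid
    { carrier := {w | ∀ φ ∈ (cayleyDigraph G S).autGroup, φ 1 = 1 → φ w = w}
      one_mem' := fun _ _ h => h
      -- Since φ fixes b, the map w ↦ φ(w b) b⁻¹ is again an automorphism fixing 1, so it fixes a.
      mul_mem' := by
        intro a b ha hb φ hφ h1
        have h : Equiv.mulRight b⁻¹ * φ * Equiv.mulRight b ∈ (cayleyDigraph G S).autGroup :=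
          mul_mem (mul_mem (mulRight_mem_autGroup S _) hφ) (mulRight_mem_autGroup S _)
        have := ha _ h (by simp [hb φ hφ h1])
        simpa [mul_inv_eq_iff_eq_mul] using this }
where
  subgroupOfFiniteSubmonoid (M : Submonoid G) : Subgroup G :=
    { M with
      inv_mem' := by
        intro a ha
        have h : a⁻¹ = a ^ (orderOf a - 1) := by
          rw [inv_eq_iff_mul_eq_one, ← pow_succ', Nat.sub_add_cancel (orderOf_pos a),
            pow_orderOf_eq_one]
        simp only [Submonoid.mem_carrier, h] at ha ⊢
        exact M.pow_mem ha _ }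

theorem mem_fixer [Finite G] {S : Set G} {w : G} :
    w ∈ fixer S ↔ ∀ φ ∈ (cayleyDigraph G S).autGroup, φ 1 = 1 → φ w = w := Iff.rfl

/-- Any automorphism followed by a suitable right translation fixes 1, hence is the identity. -/
theorem admitsORR_of_fixer_eq_top [Finite G] {S : Set G} (hS : S ∩ S⁻¹ = ∅)
    (h : fixer S = ⊤) : AdmitsORR G := by
  refine ⟨S, hS, le_antisymm ?_ ?_⟩
  · intro φ hφ
    refine ⟨MulOpposite.op (φ 1), ?_⟩
    have hm : Equiv.mulRight (φ 1)⁻¹ * φ ∈ (cayleyDigraph G S).autGroup :=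
      mul_mem (mulRight_mem_autGroup S _) hφ
    ext w
    have hw : w ∈ fixer S := h ▸ Subgroup.mem_top w
    have := mem_fixer.mp hw _ hm (by simp)
    simp only [Equiv.Perm.coe_mul, Function.comp_apply, Equiv.coe_mulRight,
      mul_inv_eq_iff_eq_mul] at this
    simpa using this.symm
  · rintro _ ⟨a, rfl⟩
    have : (MulAction.toPermHom Gᵐᵒᵖ G) a = Equiv.mulRight a.unop := by
      ext w; simp
    rw [this]
    exact mulRight_mem_autGroup S _

end Fixer

/-! ### Paths, their connection sets and the induced arcs. -/

section PathSet

variable {G : Type*} [Group G]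

/-- A sequence of non-involutions, independent modulo the Frattini subgroup, such that the
quotients of consecutive terms among the first `k` ones are non-involutions. -/
structure IsPath (x : ℕ → G) (k K : ℕ) : Prop where
  le : k ≤ K
  le_succ : K ≤ k + 1
  sq_ne : ∀ i < K, x i * x i ≠ 1
  step : ∀ i, i + 1 < k → x (i + 1) * (x i)⁻¹ * (x (i + 1) * (x i)⁻¹) ≠ 1
  indep : ∀ i < K, charVec (x i) ∉
    Submodule.span (ZMod 2) ((fun j => charVec (x j)) '' Set.Iio i)

/-- The connection set of a path: its vertices and the quotients of consecutive vertices. -/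
def pathSet (x : ℕ → G) (k K : ℕ) : Set G :=
  {s | (∃ i < K, s = x i) ∨ ∃ i, i + 1 < k ∧ s = x (i + 1) * (x i)⁻¹}

variable {x : ℕ → G} {k K : ℕ}

theorem vertex_mem_pathSet {i : ℕ} (hi : i < K) : x i ∈ pathSet x k K := Or.inl ⟨i, hi, rfl⟩

theorem quot_mem_pathSet {i : ℕ} (hi : i + 1 < k) : x (i + 1) * (x i)⁻¹ ∈ pathSet x k K :=
  Or.inr ⟨i, hi, rfl⟩

namespace IsPath

theorem sq_ne_of_mem (h : IsPath x k K) {s : G} (hs : s ∈ pathSet x k K) : s * s ≠ 1 := by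
  rcases hs with ⟨i, hi, rfl⟩ | ⟨i, hi, rfl⟩
  · exact h.sq_ne i hi
  · exact h.step i hi

theorem ne_one_of_mem (h : IsPath x k K) {s : G} (hs : s ∈ pathSet x k K) : s ≠ 1 := by
  rintro rfl
  exact h.sq_ne_of_mem hs (one_mul 1)

theorem dual (h : IsPath x k K) :
    ∃ f : ℕ → ((G →* Multiplicative (ZMod 2)) → ZMod 2) →ₗ[ZMod 2] ZMod 2,
      ∀ i < K, ∀ j < K, f i (charVec (x j)) = if i = j then 1 else 0 :=
  exists_dual_family _ K h.indep

/-- Partial sums of the dual family are useful because the i-th one takes the value 1 on the i-th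
quotient and 0 on all the other quotients. -/
theorem dual_sum (h : IsPath x k K) :
    ∃ f : ℕ → ((G →* Multiplicative (ZMod 2)) → ZMod 2) →ₗ[ZMod 2] ZMod 2,
      ∀ i < K, ∀ j < K, f i (charVec (x j)) = if j ≤ i then 1 else 0 := by
  obtain ⟨f, hf⟩ := h.dual
  refine ⟨fun i => ∑ a ∈ Finset.range (i + 1), f a, ?_⟩
  intro i hi j hj
  rw [LinearMap.sum_apply]
  rw [Finset.sum_congr rfl (g := fun a => if a = j then 1 else 0)]
  · simp
  · intro a ha
    exact hf a (lt_of_le_of_lt (Nat.lt_succ_iff.mp (Finset.mem_range.mp ha)) hi) j hj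

theorem vertex_inj (h : IsPath x k K) {i j : ℕ} (hi : i < K) (hj : j < K)
    (e : charVec (x i) = charVec (x j)) : i = j := by
  obtain ⟨f, hf⟩ := h.dual
  by_contra hij
  have h1 := hf i hi j hj
  rw [← e, hf i hi i hi] at h1
  simp [hij] at h1

/-- The functional that is one on the vertices and zero on the quotients. -/
theorem parity (h : IsPath x k K) :
    ∃ f : ((G →* Multiplicative (ZMod 2)) → ZMod 2) →ₗ[ZMod 2] ZMod 2,
      ∀ j < K, f (charVec (x j)) = 1 := by
  rcases Nat.eq_zero_or_pos K with rfl | hK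
  · exact ⟨0, fun j hj => absurd hj (Nat.not_lt_zero j)⟩
  obtain ⟨f, hf⟩ := h.dual_sum
  refine ⟨f (K - 1), fun j hj => ?_⟩
  rw [hf (K - 1) (by omega) j hj, if_pos (by omega)]

theorem vertex_ne_quot (h : IsPath x k K) {i j : ℕ} (hi : i < K) (hj : j + 1 < k) :
    charVec (x i) ≠ charVec (x (j + 1) * (x j)⁻¹) := by
  obtain ⟨f, hf⟩ := h.parity
  intro e
  have hk := h.le
  have h1 := hf i hi
  rw [e, charVec_mul, charVec_inv, map_add, hf _ (by omega), hf _ (by omega)] at h1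
  revert h1; decide

theorem quot_inj (h : IsPath x k K) {i j : ℕ} (hi : i + 1 < k) (hj : j + 1 < k)
    (e : charVec (x (i + 1) * (x i)⁻¹) = charVec (x (j + 1) * (x j)⁻¹)) : i = j := by
  obtain ⟨f, hf⟩ := h.dual_sum
  have hk := h.le
  by_contra hij
  have h1 := congrArg (f i) e
  simp only [charVec_mul, charVec_inv, map_add] at h1
  rw [hf i (by omega) _ (by omega), hf i (by omega) _ (by omega), hf i (by omega) _ (by omega),
    hf i (by omega) _ (by omega), if_neg (by omega), if_pos le_rfl] at h1
  rcases lt_or_gt_of_ne hij with hlt | hlt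
  · rw [if_neg (by omega), if_neg (by omega)] at h1
    revert h1; decide
  · rw [if_pos (by omega), if_pos (by omega)] at h1
    revert h1; decide

theorem inj (h : IsPath x k K) {s t : G} (hs : s ∈ pathSet x k K) (ht : t ∈ pathSet x k K)
    (e : charVec s = charVec t) : s = t := by
  rcases hs with ⟨i, hi, rfl⟩ | ⟨i, hi, rfl⟩ <;> rcases ht with ⟨j, hj, rfl⟩ | ⟨j, hj, rfl⟩
  · rw [h.vertex_inj hi hj e]
  · exact absurd e (h.vertex_ne_quot hi hj)
  · exact absurd e.symm (h.vertex_ne_quot hj hi)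
  · rw [h.quot_inj hi hj e]

/-- Character vectors are injective on the connection set and blind to inversion, so s and s⁻¹ both
lying there would make s an involution. -/
theorem inter_inv (h : IsPath x k K) : pathSet x k K ∩ (pathSet x k K)⁻¹ = ∅ := by
  ext s
  simp only [Set.mem_inter_iff, Set.mem_inv, Set.mem_empty_iff_false, iff_false, not_and]
  intro hs hs'
  have e := h.inj hs hs' (charVec_inv s).symm
  apply h.sq_ne_of_mem hs
  nth_rw 2 [e]
  exact mul_inv_cancel s

theorem vertices_of_quot (h : IsPath x k K) {i j m : ℕ} (hi : i < K) (hj : j < K)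
    (hm : m + 1 < k) (e : charVec (x i) + charVec (x j) = charVec (x (m + 1) * (x m)⁻¹)) :
    (i = m ∧ j = m + 1) ∨ (i = m + 1 ∧ j = m) := by
  obtain ⟨f, hf⟩ := h.dual
  have hk := h.le
  have h1 := congrArg (f m) e
  have h2 := congrArg (f (m + 1)) e
  simp only [charVec_mul, charVec_inv, map_add] at h1 h2
  rw [hf m (by omega) _ hi, hf m (by omega) _ hj, hf m (by omega) _ (by omega),
    hf m (by omega) _ (by omega), if_neg (by omega : m ≠ m + 1), if_pos rfl] at h1
  rw [hf _ (by omega) _ hi, hf _ (by omega) _ hj, hf _ (by omega) _ (by omega),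
    hf _ (by omega) _ (by omega), if_neg (by omega : m + 1 ≠ m), if_pos rfl] at h2
  by_cases a1 : m = i <;> by_cases a2 : m = j
  · simp only [a1, if_true] at h1; subst a1; subst a2; revert h1; simp
  · subst a1
    by_cases a3 : m + 1 = j
    · omega
    · simp [a3] at h2
  · subst a2
    by_cases a3 : m + 1 = i
    · omega
    · simp [a3] at h2
  · simp [a1, a2] at h1

/-- Excludes arcs in which both ends and the connecting element are quotients: the i-th partial-sum
functional is 1 on the left and 0 on the right unless two of the quotients coincide. -/
theorem quot_triple (h : IsPath x k K) {i j m : ℕ} (hi : i + 1 < k) (hj : j + 1 < k)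
    (hm : m + 1 < k) :
    x (i + 1) * (x i)⁻¹ ≠ x (j + 1) * (x j)⁻¹ * (x (m + 1) * (x m)⁻¹) := by
  intro e
  by_cases hij : i = j
  · subst hij
    have := mul_eq_left.mp e.symm
    exact h.ne_one_of_mem (K := K) (quot_mem_pathSet hm) this
  by_cases him : i = m
  · subst him
    have := mul_eq_right.mp e.symm
    exact h.ne_one_of_mem (K := K) (quot_mem_pathSet hj) this
  obtain ⟨f, hf⟩ := h.dual_sum
  have hk := h.le
  have h1 := congrArg (fun g => f i (charVec g)) e
  simp only [charVec_mul, charVec_inv, map_add] at h1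
  simp only [hf i (by omega) i (by omega), hf i (by omega) (i + 1) (by omega),
    hf i (by omega) j (by omega), hf i (by omega) (j + 1) (by omega),
    hf i (by omega) m (by omega), hf i (by omega) (m + 1) (by omega)] at h1
  have key : ∀ j, i ≠ j → ((if j + 1 ≤ i then 1 else 0) + (if j ≤ i then 1 else 0) : ZMod 2) = 0 := by
    intro j hj
    rcases lt_or_gt_of_ne hj with hlt | hlt
    · rw [if_neg (by omega), if_neg (by omega)]; decide
    · rw [if_pos (by omega), if_pos (by omega)]; decide
  rw [key j hij, key m him, if_neg (by omega), if_pos le_rfl] at h1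
  revert h1; decide

/-- The arcs of `Cay(G, S)` between elements of the connection set `S` of a path. -/
theorem arc_iff (h : IsPath x k K) {s t : G} :
    (s ∈ pathSet x k K ∧ t ∈ pathSet x k K ∧ t * s⁻¹ ∈ pathSet x k K) ↔
    ∃ m, m + 1 < k ∧
      ((s = x m ∧ t = x (m + 1)) ∨
       (s = x (m + 1) * (x m)⁻¹ ∧ t = x m ∧ x m * x m = x (m + 1) * x (m + 1)) ∨
       (s = x (m + 1) ∧ t = x (m + 1) * (x m)⁻¹ ∧ x (m + 1) * (x m)⁻¹ = x m * x (m + 1)) ∨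
       (s = x (m + 1) * (x m)⁻¹ ∧ t = x (m + 1) ∧ Commute (x m) (x (m + 1)))) := by
  have hk := h.le
  constructor
  · rintro ⟨hs, ht, hr⟩
    -- By parity, an even number of s, t and r = t s⁻¹ are vertices. Three quotients are impossible,
    -- so there are two vertices and one quotient, and independence makes them x_m, x_{m+1} and the
    -- m-th quotient. Of the six arrangements, two would make the quotient or x_m an involution; the
    -- other four are listed.
    obtain ⟨f, hf⟩ := h.parity
    have hy : ∀ m, m + 1 < k → f (charVec (x (m + 1) * (x m)⁻¹)) = 0 := by
      intro m hm
      rw [charVec_mul, charVec_inv, map_add, hf _ (by omega), hf _ (by omega)]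
      decide
    obtain ⟨r, hr', e⟩ : ∃ r, r ∈ pathSet x k K ∧ t = r * s := ⟨_, hr, by group⟩
    have ec : charVec t = charVec r + charVec s := by rw [e, charVec_mul]
    have ef := congrArg f ec
    rw [map_add] at ef
    have flip : ∀ {a b c : (G →* Multiplicative (ZMod 2)) → ZMod 2}, a = b + c → a + b = c := by
      rintro a b c rfl
      rw [add_right_comm, zmod_two_add_self, zero_add]
    clear hr
    rcases hs with ⟨i, hi, rfl⟩ | ⟨i, hi, rfl⟩ <;> rcases ht with ⟨j, hj, rfl⟩ | ⟨j, hj, rfl⟩ <;>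
      rcases hr' with ⟨m, hm, rfl⟩ | ⟨m, hm, rfl⟩
    · simp only [hf i hi, hf j hj, hf m hm] at ef; exact absurd ef (by decide)
    · rcases h.vertices_of_quot hj hi hm (by rw [add_comm] at ec; exact flip ec) with
        ⟨rfl, rfl⟩ | ⟨rfl, rfl⟩
      · exfalso
        apply h.step j hm
        nth_rw 2 [e]
        group
      · exact ⟨i, hm, Or.inl ⟨rfl, rfl⟩⟩
    · rcases h.vertices_of_quot hm hi hj ec.symm with ⟨rfl, rfl⟩ | ⟨rfl, rfl⟩
      · exact ⟨m, hj, Or.inr (Or.inr (Or.inl ⟨rfl, rfl, e⟩))⟩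
      · exfalso
        rw [mul_right_inj] at e
        apply h.sq_ne i hi
        nth_rw 2 [← e]
        exact mul_inv_cancel _
    · simp only [hf i hi, hy j hj, hy m hm] at ef; exact absurd ef (by decide)
    · rcases h.vertices_of_quot hj hm hi (flip ec) with ⟨rfl, rfl⟩ | ⟨rfl, rfl⟩
      · refine ⟨j, hi, Or.inr (Or.inl ⟨rfl, rfl, ?_⟩)⟩
        nth_rw 1 [e]
        group
      · refine ⟨m, hi, Or.inr (Or.inr (Or.inr ⟨rfl, rfl, ?_⟩))⟩
        rw [← mul_assoc, eq_mul_inv_iff_mul_eq] at e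
        exact e.symm
    · simp only [hy i hi, hf j hj, hy m hm] at ef; exact absurd ef (by decide)
    · simp only [hy i hi, hy j hj, hf m hm] at ef; exact absurd ef (by decide)
    · exact absurd e (h.quot_triple hj hm hi)
  · rintro ⟨m, hm, ⟨rfl, rfl⟩ | ⟨rfl, rfl, e⟩ | ⟨rfl, rfl, e⟩ | ⟨rfl, rfl, e⟩⟩
    · exact ⟨vertex_mem_pathSet (by omega), vertex_mem_pathSet (by omega), quot_mem_pathSet hm⟩
    · refine ⟨quot_mem_pathSet hm, vertex_mem_pathSet (by omega), ?_⟩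
      have : x m * (x (m + 1) * (x m)⁻¹)⁻¹ = x (m + 1) := by
        rw [mul_inv_rev, inv_inv, ← mul_assoc, e]; group
      rw [this]
      exact vertex_mem_pathSet (by omega)
    · refine ⟨vertex_mem_pathSet (by omega), quot_mem_pathSet hm, ?_⟩
      rw [e, mul_inv_cancel_right]
      exact vertex_mem_pathSet (by omega)
    · refine ⟨quot_mem_pathSet hm, vertex_mem_pathSet (by omega), ?_⟩
      have : x (m + 1) * (x (m + 1) * (x m)⁻¹)⁻¹ = x m := by
        rw [mul_inv_rev, inv_inv, ← mul_assoc, ← e.eq]; group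
      rw [this]
      exact vertex_mem_pathSet (by omega)

end IsPath

end PathSet

/-! ### Rigidity of the digraph induced on the connection set. -/

section Rigidity

variable {G : Type*} [Group G]

/-- The arcs between elements of `S` in `Cay(G, S)`. -/
def linkArc (S : Set G) (s t : G) : Prop := s ∈ S ∧ t ∈ S ∧ t * s⁻¹ ∈ S

/-- The middle vertices of induced directed paths of length two in the out-neighbourhood of the
identity. -/
def linkMid (S : Set G) (v : G) : Prop :=
  ∃ w w', linkArc S w v ∧ linkArc S v w' ∧ ¬ linkArc S w w' ∧ ¬ linkArc S w' w

theorem mem_iff_of_mem_autGroup {S : Set G} {φ : Equiv.Perm G}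
    (hφ : φ ∈ (cayleyDigraph G S).autGroup) (h1 : φ 1 = 1) (s : G) : φ s ∈ S ↔ s ∈ S := by
  have := mem_autGroup_cayleyDigraph.mp hφ 1 s
  simpa [h1] using this

theorem linkArc_iff_of_mem_autGroup {S : Set G} {φ : Equiv.Perm G}
    (hφ : φ ∈ (cayleyDigraph G S).autGroup) (h1 : φ 1 = 1) (s t : G) :
    linkArc S (φ s) (φ t) ↔ linkArc S s t := by
  unfold linkArc
  rw [mem_iff_of_mem_autGroup hφ h1, mem_iff_of_mem_autGroup hφ h1,
    mem_autGroup_cayleyDigraph.mp hφ]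

theorem linkMid_of_mem_autGroup {S : Set G} {φ : Equiv.Perm G}
    (hφ : φ ∈ (cayleyDigraph G S).autGroup) (h1 : φ 1 = 1) {v : G} (hv : linkMid S v) :
    linkMid S (φ v) := by
  obtain ⟨w, w', h⟩ := hv
  refine ⟨φ w, φ w', ?_⟩
  simpa only [linkArc_iff_of_mem_autGroup hφ h1] using h

namespace IsPath

variable {x : ℕ → G} {k K : ℕ}

theorem linkArc_vertex (h : IsPath x k K) {i j : ℕ} (hi : i < K) (hj : j < K) :
    linkArc (pathSet x k K) (x i) (x j) ↔ j = i + 1 ∧ j < k := by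
  have hk := h.le
  unfold linkArc
  rw [h.arc_iff]
  constructor
  · rintro ⟨m, hm, ⟨e1, e2⟩ | ⟨e1, e2, -⟩ | ⟨e1, e2, -⟩ | ⟨e1, e2, -⟩⟩
    · have := h.vertex_inj hi (by omega) (congrArg charVec e1)
      have := h.vertex_inj hj (by omega) (congrArg charVec e2)
      omega
    · exact absurd (congrArg charVec e1) (h.vertex_ne_quot hi hm)
    · exact absurd (congrArg charVec e2) (h.vertex_ne_quot hj hm)
    · exact absurd (congrArg charVec e1) (h.vertex_ne_quot hi hm)
  · rintro ⟨rfl, hj'⟩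
    exact ⟨i, hj', Or.inl ⟨rfl, rfl⟩⟩

/-- The out-neighbours of a vertex of the path. -/
theorem linkArc_left (h : IsPath x k K) {i : ℕ} {t : G} (hi : i < K)
    (ht : linkArc (pathSet x k K) (x i) t) :
    (i + 1 < k ∧ t = x (i + 1)) ∨
      ∃ m, m + 1 = i ∧ i < k ∧ t = x i * (x m)⁻¹ ∧ x i * (x m)⁻¹ = x m * x i := by
  have hk := h.le
  unfold linkArc at ht
  rw [h.arc_iff] at ht
  obtain ⟨m, hm, ⟨e1, e2⟩ | ⟨e1, e2, -⟩ | ⟨e1, e2, e3⟩ | ⟨e1, e2, -⟩⟩ := ht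
  · obtain rfl := h.vertex_inj hi (by omega) (congrArg charVec e1)
    exact Or.inl ⟨hm, e2⟩
  · exact absurd (congrArg charVec e1) (h.vertex_ne_quot hi hm)
  · obtain rfl := h.vertex_inj hi (by omega) (congrArg charVec e1)
    exact Or.inr ⟨m, rfl, hm, e2, e3⟩
  · exact absurd (congrArg charVec e1) (h.vertex_ne_quot hi hm)

/-- The in-neighbours of a vertex of the path. -/
theorem linkArc_right (h : IsPath x k K) {i : ℕ} {s : G} (hi : i < K)
    (hs : linkArc (pathSet x k K) s (x i)) :
    (∃ m, m + 1 = i ∧ i < k ∧ s = x m) ∨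
      (i + 1 < k ∧ s = x (i + 1) * (x i)⁻¹ ∧ x i * x i = x (i + 1) * x (i + 1)) ∨
      ∃ m, m + 1 = i ∧ i < k ∧ s = x i * (x m)⁻¹ ∧ Commute (x m) (x i) := by
  have hk := h.le
  unfold linkArc at hs
  rw [h.arc_iff] at hs
  obtain ⟨m, hm, ⟨e1, e2⟩ | ⟨e1, e2, e3⟩ | ⟨e1, e2, -⟩ | ⟨e1, e2, e3⟩⟩ := hs
  · obtain rfl := h.vertex_inj hi (by omega) (congrArg charVec e2)
    exact Or.inl ⟨m, rfl, hm, e1⟩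
  · obtain rfl := h.vertex_inj hi (by omega) (congrArg charVec e2)
    exact Or.inr (Or.inl ⟨hm, e1, e3⟩)
  · exact absurd (congrArg charVec e2) (h.vertex_ne_quot hi hm)
  · obtain rfl := h.vertex_inj hi (by omega) (congrArg charVec e2)
    exact Or.inr (Or.inr ⟨m, rfl, hm, e1, e3⟩)

theorem linkArc_quot_left (h : IsPath x k K) {i : ℕ} {t : G} (hi : i + 1 < k)
    (ht : linkArc (pathSet x k K) (x (i + 1) * (x i)⁻¹) t) :
    (t = x i ∧ x i * x i = x (i + 1) * x (i + 1)) ∨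
      (t = x (i + 1) ∧ Commute (x i) (x (i + 1))) := by
  have hk := h.le
  unfold linkArc at ht
  rw [h.arc_iff] at ht
  obtain ⟨m, hm, ⟨e1, e2⟩ | ⟨e1, e2, e3⟩ | ⟨e1, e2, -⟩ | ⟨e1, e2, e3⟩⟩ := ht
  · exact absurd (congrArg charVec e1).symm (h.vertex_ne_quot (by omega) hi)
  · obtain rfl := h.quot_inj hi hm (congrArg charVec e1)
    exact Or.inl ⟨e2, e3⟩
  · exact absurd (congrArg charVec e1).symm (h.vertex_ne_quot (by omega) hi)
  · obtain rfl := h.quot_inj hi hm (congrArg charVec e1)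
    exact Or.inr ⟨e2, e3⟩

theorem linkArc_quot_right (h : IsPath x k K) {i : ℕ} {s : G} (hi : i + 1 < k)
    (hs : linkArc (pathSet x k K) s (x (i + 1) * (x i)⁻¹)) :
    s = x (i + 1) ∧ x (i + 1) * (x i)⁻¹ = x i * x (i + 1) := by
  have hk := h.le
  unfold linkArc at hs
  rw [h.arc_iff] at hs
  obtain ⟨m, hm, ⟨e1, e2⟩ | ⟨e1, e2, e3⟩ | ⟨e1, e2, e3⟩ | ⟨e1, e2, e3⟩⟩ := hs
  · exact absurd (congrArg charVec e2).symm (h.vertex_ne_quot (by omega) hi)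
  · exact absurd (congrArg charVec e2).symm (h.vertex_ne_quot (by omega) hi)
  · obtain rfl := h.quot_inj hi hm (congrArg charVec e2)
    exact ⟨e1, e3⟩
  · exact absurd (congrArg charVec e2).symm (h.vertex_ne_quot (by omega) hi)

/-- Commuting neighbours x_i, x_{i+1} would satisfy neither of the other two special relations; this
and the next lemma exclude them in turn. -/
theorem not_commute_of_inverts (h : IsPath x k K) {i : ℕ} (hi : i + 1 < k)
    (hb : x (i + 1) * (x i)⁻¹ = x i * x (i + 1)) : ¬ Commute (x i) (x (i + 1)) := by
  intro hc
  have hk := h.le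
  rw [hc.eq, mul_right_inj] at hb
  apply h.sq_ne i (by omega)
  nth_rw 1 [← hb]
  exact inv_mul_cancel _

theorem not_commute_of_sq_eq (h : IsPath x k K) {i : ℕ} (hi : i + 1 < k)
    (ha : x i * x i = x (i + 1) * x (i + 1)) : ¬ Commute (x i) (x (i + 1)) := by
  intro hc
  apply h.step i hi
  have e : x (i + 1) * (x i)⁻¹ = (x i)⁻¹ * x (i + 1) := hc.inv_left.eq.symm
  nth_rw 1 [e]
  rw [mul_assoc, ← mul_assoc (x (i + 1)), ← ha]
  group

theorem linkMid_vertex (h : IsPath x k K) {i : ℕ} (h1 : 1 ≤ i) (hi : i + 1 < k) :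
    linkMid (pathSet x k K) (x i) := by
  have hk := h.le
  refine ⟨x (i - 1), x (i + 1), ?_, ?_, ?_, ?_⟩ <;>
    rw [h.linkArc_vertex (by omega) (by omega)] <;> omega

/-- A quotient can only be entered from x_{i+1}. If it is left towards x_i, the arc x_i → x_{i+1}
closes a triangle, so the 2-path is not induced; leaving towards x_{i+1} needs a commuting pair,
which the incoming arc forbids. -/
theorem exists_vertex_of_linkMid (h : IsPath x k K) {v : G}
    (hv : linkMid (pathSet x k K) v) : ∃ i < k, v = x i := by
  have hk := h.le
  obtain ⟨w, w', h1, h2, h3, h4⟩ := hv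
  rcases h1.2.1 with ⟨i, hi, rfl⟩ | ⟨i, hi, rfl⟩
  · refine ⟨i, ?_, rfl⟩
    rcases h.linkArc_left hi h2 with ⟨h5, -⟩ | ⟨m, -, h5, -⟩ <;> omega
  · exfalso
    obtain ⟨rfl, hb⟩ := h.linkArc_quot_right hi h1
    rcases h.linkArc_quot_left hi h2 with ⟨rfl, -⟩ | ⟨-, hc⟩
    · exact h4 ((h.linkArc_vertex (by omega) (by omega)).mpr ⟨rfl, hi⟩)
    · exact h.not_commute_of_inverts hi hb hc

variable [Finite G]

/-- The inner vertices of a path are fixed by all automorphisms that fix the identity. -/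
theorem vertex_mem_fixer (h : IsPath x k K) {i : ℕ} (h1 : 1 ≤ i) (hi : i + 1 < k) :
    x i ∈ fixer (pathSet x k K) := by
  have hk := h.le
  rw [mem_fixer]
  intro φ hφ hφ1
  have himg : ∀ i, linkMid (pathSet x k K) (x i) →
      ∃ j < k, φ (x i) = x j ∧ linkMid (pathSet x k K) (x j) := by
    intro i hmid
    have hm := linkMid_of_mem_autGroup hφ hφ1 hmid
    obtain ⟨j, hj, e⟩ := h.exists_vertex_of_linkMid hm
    exact ⟨j, hj, e, e ▸ hm⟩
  have hstep : ∀ i i' j j', i < k → i' < k → i' = i + 1 → j < k → j' < k → φ (x i) = x j →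
      φ (x i') = x j' → j' = j + 1 := by
    intro i i' j j' hi hi' e hj hj' ej ej'
    have := (linkArc_iff_of_mem_autGroup hφ hφ1 (x i) (x i')).mpr
      ((h.linkArc_vertex (by omega) (by omega)).mpr ⟨e, hi'⟩)
    rw [ej, ej', h.linkArc_vertex (by omega) (by omega)] at this
    exact this.1
  obtain ⟨j₁, hj₁, e₁, hmid₁⟩ := himg 1 (h.linkMid_vertex le_rfl (by omega))
  have hshift : ∀ n, n + 2 < k → j₁ + n < k ∧ φ (x (1 + n)) = x (j₁ + n) ∧
      linkMid (pathSet x k K) (x (j₁ + n)) := by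
    intro n
    induction n with
    | zero => exact fun _ => ⟨hj₁, e₁, hmid₁⟩
    | succ n ih =>
      intro hn
      obtain ⟨hlt, e, -⟩ := ih (by omega)
      obtain ⟨j', hj', e', hmid'⟩ := himg (1 + (n + 1)) (h.linkMid_vertex (by omega) (by omega))
      obtain rfl := hstep _ _ _ _ (by omega) (by omega) (by omega) hlt hj' e e'
      exact ⟨hj', e', hmid'⟩
  -- The inner vertices are mapped to a shifted segment. A shift down makes x_0 a middle vertex
  -- whose image would precede x_0; a shift up makes x_{k-1} one whose image would follow x_{k-1}.
  have hj1 : j₁ = 1 := by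
    by_contra hne
    rcases Nat.lt_or_gt_of_ne hne with hlt | hgt
    · obtain rfl : j₁ = 0 := by omega
      obtain ⟨j', hj', e', -⟩ := himg 0 hmid₁
      have := hstep 0 1 j' 0 (by omega) (by omega) rfl hj' hj₁ e' e₁
      omega
    · obtain ⟨hlt, e, hmid⟩ := hshift (k - 3) (by omega)
      have e2 : j₁ + (k - 3) = k - 1 := by omega
      have e3 : 1 + (k - 3) = k - 2 := by omega
      rw [e2] at e hmid
      rw [e3] at e
      obtain ⟨j', hj', e', -⟩ := himg (k - 1) hmid
      have := hstep (k - 2) (k - 1) (k - 1) j' (by omega) (by omega) (by omega) (by omega) hj' e e'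
      omega
  obtain ⟨-, e, -⟩ := hshift (i - 1) (by omega)
  rw [hj1] at e
  rwa [show 1 + (i - 1) = i by omega] at e

theorem eq_of_apply_mem_fixer {S : Set G} {φ : Equiv.Perm G}
    (hφ : φ ∈ (cayleyDigraph G S).autGroup) (h1 : φ 1 = 1) {w v : G} (hv : v ∈ fixer S)
    (h : φ w = v) : w = v :=
  φ.injective (h.trans (mem_fixer.mp hv φ hφ h1).symm)

/-- If all vertices among the first `k` ones are fixed by the automorphisms fixing the identity,
and the vertices generate the group, then the connection set of the path yields an ORR. -/
theorem admitsORR (h : IsPath x k K) (hG : IsPGroup 2 G)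
    (hspan : ∀ g : G, charVec g ∈
      Submodule.span (ZMod 2) ((fun j => charVec (x j)) '' Set.Iio K))
    (hfix : ∀ i < k, x i ∈ fixer (pathSet x k K)) : AdmitsORR G := by
  have hk := h.le
  have hk' := h.le_succ
  refine admitsORR_of_fixer_eq_top h.inter_inv ?_
  have hall : ∀ i < K, x i ∈ fixer (pathSet x k K) := by
    intro i hi
    by_cases hik : i < k
    · exact hfix i hik
    -- This is the isolated vertex, present when K = k + 1. All other elements of the connection set
    -- are fixed, so it cannot be moved onto any of them.
    rw [mem_fixer]
    intro φ hφ hφ1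
    have hm := (mem_iff_of_mem_autGroup hφ hφ1 (x i)).mpr (vertex_mem_pathSet hi)
    rcases hm with ⟨j, hj, e⟩ | ⟨j, hj, e⟩
    · by_cases hjk : j < k
      · rw [e]; exact (eq_of_apply_mem_fixer hφ hφ1 (hfix j hjk) e).symm
      · rw [e, show j = i by omega]
    · rw [e]
      exact (eq_of_apply_mem_fixer hφ hφ1
        (mul_mem (hfix _ hj) (inv_mem (hfix j (by omega)))) e).symm
  rw [eq_top_iff, ← closure_eq_top_of_charVec hG (x '' Set.Iio K)
    (by rw [Set.image_image]; exact hspan), Subgroup.closure_le]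
  rintro _ ⟨i, hi, rfl⟩
  exact hall i hi

/-- The fixed vertex x_{k-2} has at most one out-neighbour besides x_{k-1}, a quotient of two inner
vertices. Dually, the in-neighbours of x_1 other than x_0 are x_2 x_1⁻¹, already fixed, and x_1
x_0⁻¹, which would need x_0 and x_1 to commute. -/
theorem fixer_of_four_le (h : IsPath x k K) (hk4 : 4 ≤ k) (hc : ¬ Commute (x 0) (x 1)) :
    ∀ i < k, x i ∈ fixer (pathSet x k K) := by
  have hk := h.le
  have hlast : x (k - 1) ∈ fixer (pathSet x k K) := by
    rw [mem_fixer]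
    intro φ hφ hφ1
    have harc := (linkArc_iff_of_mem_autGroup hφ hφ1 (x (k - 2)) (x (k - 1))).mpr
      ((h.linkArc_vertex (by omega) (by omega)).mpr ⟨by omega, by omega⟩)
    rw [mem_fixer.mp (h.vertex_mem_fixer (by omega) (by omega)) φ hφ hφ1] at harc
    rcases h.linkArc_left (by omega) harc with ⟨-, e⟩ | ⟨m, hm, -, e, -⟩
    · rw [e]; congr 1; omega
    · rw [e]
      refine (eq_of_apply_mem_fixer hφ hφ1 (mul_mem (h.vertex_mem_fixer (by omega) (by omega))
        (inv_mem (h.vertex_mem_fixer (by omega) (by omega)))) e).symm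
  have hpos : ∀ i, 1 ≤ i → i < k → x i ∈ fixer (pathSet x k K) := by
    intro i h1 hi
    by_cases hik : i + 1 < k
    · exact h.vertex_mem_fixer h1 hik
    · rw [show i = k - 1 by omega]; exact hlast
  intro i hi
  rcases Nat.eq_zero_or_pos i with rfl | hi0
  · rw [mem_fixer]
    intro φ hφ hφ1
    have harc := (linkArc_iff_of_mem_autGroup hφ hφ1 (x 0) (x 1)).mpr
      ((h.linkArc_vertex (by omega) (by omega)).mpr ⟨by omega, by omega⟩)
    rw [mem_fixer.mp (hpos 1 le_rfl (by omega)) φ hφ hφ1] at harc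
    rcases h.linkArc_right (by omega) harc with ⟨m, hm, -, e⟩ | ⟨h2, e, -⟩ | ⟨m, hm, -, -, hcm⟩
    · rw [e]; congr 1; omega
    · rw [e]
      exact (eq_of_apply_mem_fixer hφ hφ1 (mul_mem (hpos 2 (by omega) (by omega))
        (inv_mem (hpos 1 le_rfl (by omega)))) e).symm
    · obtain rfl : m = 0 := by omega
      exact absurd hcm hc
  · exact hpos i hi0 hi

/-- Only x_1 is inner. A nontrivial automorphism would have to send x_0 to x_2 x_1⁻¹ and x_2 to x_1
x_0⁻¹, so both must be neighbours of x_1 on the right side. It would also match the possible arc x_1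
x_0⁻¹ → x_0 with x_2 → x_2 x_1⁻¹, so exactly one of them being present is an obstruction. -/
theorem fixer_of_eq_three (h : IsPath x 3 K) (hc : ¬ Commute (x 0) (x 1))
    (hgood : ¬ (x 1 * (x 0)⁻¹ = x 0 * x 1 ∧ x 1 * x 1 = x 2 * x 2 ∧
      (x 0 * x 0 = x 1 * x 1 ↔ x 2 * (x 1)⁻¹ = x 1 * x 2))) :
    ∀ i < 3, x i ∈ fixer (pathSet x 3 K) := by
  have hk := h.le
  have f1 : x 1 ∈ fixer (pathSet x 3 K) := h.vertex_mem_fixer le_rfl (by omega)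
  have himg0 : ∀ φ ∈ (cayleyDigraph G (pathSet x 3 K)).autGroup, φ 1 = 1 →
      φ (x 0) = x 0 ∨ (φ (x 0) = x 2 * (x 1)⁻¹ ∧ x 1 * x 1 = x 2 * x 2) := by
    intro φ hφ hφ1
    have harc := (linkArc_iff_of_mem_autGroup hφ hφ1 (x 0) (x 1)).mpr
      ((h.linkArc_vertex (by omega) (by omega)).mpr ⟨by omega, by omega⟩)
    rw [mem_fixer.mp f1 φ hφ hφ1] at harc
    rcases h.linkArc_right (by omega) harc with ⟨m, hm, -, e⟩ | ⟨-, e, ha⟩ | ⟨m, hm, -, -, hcm⟩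
    · obtain rfl : m = 0 := by omega
      exact Or.inl e
    · exact Or.inr ⟨e, ha⟩
    · obtain rfl : m = 0 := by omega
      exact absurd hcm hc
  have himg2 : ∀ φ ∈ (cayleyDigraph G (pathSet x 3 K)).autGroup, φ 1 = 1 →
      φ (x 2) = x 2 ∨ (φ (x 2) = x 1 * (x 0)⁻¹ ∧ x 1 * (x 0)⁻¹ = x 0 * x 1) := by
    intro φ hφ hφ1
    have harc := (linkArc_iff_of_mem_autGroup hφ hφ1 (x 1) (x 2)).mpr
      ((h.linkArc_vertex (by omega) (by omega)).mpr ⟨by omega, by omega⟩)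
    rw [mem_fixer.mp f1 φ hφ hφ1] at harc
    rcases h.linkArc_left (by omega) harc with ⟨-, e⟩ | ⟨m, hm, -, e, hb⟩
    · exact Or.inl e
    · obtain rfl : m = 0 := by omega
      exact Or.inr ⟨e, hb⟩
  have from0 : x 0 ∈ fixer (pathSet x 3 K) → x 2 ∈ fixer (pathSet x 3 K) := by
    intro f0
    rw [mem_fixer]
    intro φ hφ hφ1
    rcases himg2 φ hφ hφ1 with e | ⟨e, -⟩
    · exact e
    · rw [e]
      exact (eq_of_apply_mem_fixer hφ hφ1 (mul_mem f1 (inv_mem f0)) e).symm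
  have from2 : x 2 ∈ fixer (pathSet x 3 K) → x 0 ∈ fixer (pathSet x 3 K) := by
    intro f2
    rw [mem_fixer]
    intro φ hφ hφ1
    rcases himg0 φ hφ hφ1 with e | ⟨e, -⟩
    · exact e
    · rw [e]
      exact (eq_of_apply_mem_fixer hφ hφ1 (mul_mem f2 (inv_mem f1)) e).symm
  have key : x 0 ∈ fixer (pathSet x 3 K) ∨ x 2 ∈ fixer (pathSet x 3 K) := by
    by_cases hb0 : x 1 * (x 0)⁻¹ = x 0 * x 1
    swap
    · right
      rw [mem_fixer]
      intro φ hφ hφ1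
      exact (himg2 φ hφ hφ1).resolve_right fun e => hb0 e.2
    by_cases ha1 : x 1 * x 1 = x 2 * x 2
    swap
    · left
      rw [mem_fixer]
      intro φ hφ hφ1
      exact (himg0 φ hφ hφ1).resolve_right fun e => ha1 e.2
    by_cases ha0 : x 0 * x 0 = x 1 * x 1
    · have hb1 : x 2 * (x 1)⁻¹ ≠ x 1 * x 2 := fun hb1 =>
        hgood ⟨hb0, ha1, iff_of_true ha0 hb1⟩
      left
      rw [mem_fixer]
      intro φ hφ hφ1
      refine (himg0 φ hφ hφ1).resolve_right fun e => ?_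
      have harc : linkArc (pathSet x 3 K) (x (0 + 1) * (x 0)⁻¹) (x 0) :=
        h.arc_iff.mpr ⟨0, by omega, Or.inr (Or.inl ⟨rfl, rfl, ha0⟩)⟩
      rw [← linkArc_iff_of_mem_autGroup hφ hφ1, e.1] at harc
      exact hb1 (h.linkArc_quot_right (i := 1) (by omega) harc).2
    · have hb1 : x 2 * (x 1)⁻¹ = x 1 * x 2 := by
        by_contra hb1
        exact hgood ⟨hb0, ha1, iff_of_false ha0 hb1⟩
      right
      rw [mem_fixer]
      intro φ hφ hφ1
      refine (himg2 φ hφ hφ1).resolve_right fun e => ?_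
      have harc : linkArc (pathSet x 3 K) (x (1 + 1)) (x (1 + 1) * (x 1)⁻¹) :=
        h.arc_iff.mpr ⟨1, by omega, Or.inr (Or.inr (Or.inl ⟨rfl, rfl, hb1⟩))⟩
      rw [← linkArc_iff_of_mem_autGroup hφ hφ1, show φ (x (1 + 1)) = x 1 * (x 0)⁻¹ from e.1] at harc
      rcases h.linkArc_quot_left (i := 0) (by omega) harc with ⟨-, h5⟩ | ⟨-, h5⟩
      · exact ha0 h5
      · exact hc h5
  have f02 : x 0 ∈ fixer (pathSet x 3 K) ∧ x 2 ∈ fixer (pathSet x 3 K) := by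
    rcases key with f | f
    · exact ⟨f, from0 f⟩
    · exact ⟨from2 f, f⟩
  intro i hi
  interval_cases i
  · exact f02.1
  · exact f1
  · exact f02.2

/-- On x_0, x_1 and their quotient the only ambiguity is a directed triangle, which needs both
relations excluded by `hgood`. -/
theorem fixer_of_eq_two (h : IsPath x 2 K) (hc : ¬ Commute (x 0) (x 1))
    (hgood : ¬ (x 0 * x 0 = x 1 * x 1 ∧ x 1 * (x 0)⁻¹ = x 0 * x 1)) :
    ∀ i < 2, x i ∈ fixer (pathSet x 2 K) := by
  have hk := h.le
  have arc01 : linkArc (pathSet x 2 K) (x 0) (x 1) :=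
    (h.linkArc_vertex (by omega) (by omega)).mpr ⟨by omega, by omega⟩
  have out0 : ∀ t, linkArc (pathSet x 2 K) (x 0) t → t = x 1 := by
    intro t ht
    rcases h.linkArc_left (by omega) ht with ⟨-, e⟩ | ⟨m, hm, -⟩
    · exact e
    · omega
  have f0 : x 0 ∈ fixer (pathSet x 2 K) := by
    rw [mem_fixer]
    intro φ hφ hφ1
    have harc := (linkArc_iff_of_mem_autGroup hφ hφ1 _ _).mpr arc01
    rcases harc.1 with ⟨i, hi, e⟩ | ⟨i, hi, e⟩
    · rw [e] at harc
      rcases h.linkArc_left hi harc with ⟨h1, -⟩ | ⟨m, hm, h1, e', hb⟩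
      · rw [e, show i = 0 by omega]
      · exfalso
        obtain rfl : m = 0 := by omega
        obtain rfl : i = 1 := by omega
        have arc' := (linkArc_iff_of_mem_autGroup hφ hφ1 (x 1) (x 1 * (x 0)⁻¹)).mpr
          (h.arc_iff.mpr ⟨0, by omega, Or.inr (Or.inr (Or.inl ⟨rfl, rfl, hb⟩))⟩)
        rw [e'] at arc'
        rcases h.linkArc_quot_left (i := 0) (by omega) arc' with ⟨-, h5⟩ | ⟨-, h5⟩
        · exact hgood ⟨h5, hb⟩
        · exact hc h5
    · exfalso
      obtain rfl : i = 0 := by omega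
      rw [e] at harc
      rcases h.linkArc_quot_left (i := 0) (by omega) harc with ⟨-, ha⟩ | ⟨-, h5⟩
      · have arc' := (linkArc_iff_of_mem_autGroup hφ hφ1 (x 1 * (x 0)⁻¹) (x 0)).mpr
          (h.arc_iff.mpr ⟨0, by omega, Or.inr (Or.inl ⟨rfl, rfl, ha⟩)⟩)
        rw [e] at arc'
        exact hgood ⟨ha, (h.linkArc_quot_right (i := 0) (by omega) arc').2⟩
      · exact hc h5
  intro i hi
  interval_cases i
  · exact f0
  · rw [mem_fixer]
    intro φ hφ hφ1
    have harc := (linkArc_iff_of_mem_autGroup hφ hφ1 _ _).mpr arc01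
    rw [mem_fixer.mp f0 φ hφ hφ1] at harc
    exact out0 _ harc

end IsPath

end Rigidity

/-! ### Extending paths by one vertex. -/

section Extension

variable {G : Type*} [Group G]

/-- The span of the character vectors of the first `k` terms of a sequence. -/
def pathSpan (x : ℕ → G) (k : ℕ) : Submodule (ZMod 2) ((G →* Multiplicative (ZMod 2)) → ZMod 2) :=
  Submodule.span (ZMod 2) ((fun j => charVec (x j)) '' Set.Iio k)

theorem pathSpan_zero (x : ℕ → G) : pathSpan x 0 = ⊥ := by
  simp [pathSpan]

theorem pathSpan_succ (x : ℕ → G) (k : ℕ) :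
    pathSpan x (k + 1) = pathSpan x k ⊔ Submodule.span (ZMod 2) {charVec (x k)} := by
  have : Set.Iio (k + 1) = insert k (Set.Iio k) := by
    ext i; simp only [Set.mem_Iio, Set.mem_insert_iff]; omega
  rw [pathSpan, this, Set.image_insert_eq, Submodule.span_insert, sup_comm, pathSpan]

theorem pathSpan_congr {x x' : ℕ → G} {k : ℕ} (h : ∀ i < k, x i = x' i) :
    pathSpan x k = pathSpan x' k := by
  unfold pathSpan
  congr 1
  refine Set.image_congr fun i hi => ?_
  rw [h i hi]

theorem charVec_mem_pathSpan (x : ℕ → G) {i k : ℕ} (h : i < k) :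
    charVec (x i) ∈ pathSpan x k := Submodule.subset_span ⟨i, h, rfl⟩

theorem pathSpan_two (x : ℕ → G) :
    pathSpan x 2 = Submodule.span (ZMod 2) {charVec (x 0), charVec (x 1)} := by
  rw [pathSpan_succ, pathSpan_succ, pathSpan_zero, bot_sup_eq, ← Submodule.span_union]; rfl

namespace IsPath

variable {x : ℕ → G} {k K : ℕ}

theorem indep' (h : IsPath x k K) {i : ℕ} (hi : i < K) : charVec (x i) ∉ pathSpan x i :=
  h.indep i hi

theorem congr (h : IsPath x k K) {x' : ℕ → G} (e : ∀ i < K, x' i = x i) : IsPath x' k K where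
  le := h.le
  le_succ := h.le_succ
  sq_ne i hi := by rw [e i hi]; exact h.sq_ne i hi
  step i hi := by
    have := h.le
    rw [e i (by omega), e (i + 1) (by omega)]; exact h.step i hi
  indep i hi := by
    have h1 := h.indep' hi
    rw [← e i hi, pathSpan_congr fun j hj => (e j (hj.trans hi)).symm] at h1
    exact h1

theorem initial (h : IsPath x k K) {j : ℕ} (hj : j ≤ k) : IsPath x j j where
  le := le_rfl
  le_succ := Nat.le_succ j
  sq_ne i hi := h.sq_ne i (by have := h.le; omega)
  step i hi := h.step i (by omega)
  indep i hi := h.indep i (by have := h.le; omega)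

/-- The new vertex is isolated: k stays put, so no quotient with it enters the connection set and
none has to be a non-involution. -/
theorem addVertex (h : IsPath x k k) {s : G} (hs : s * s ≠ 1) (hi : charVec s ∉ pathSpan x k) :
    IsPath (Function.update x k s) k (k + 1) := by
  have e : ∀ i < k, Function.update x k s i = x i := fun i hi =>
    Function.update_of_ne hi.ne _ _
  have h' := h.congr e
  refine ⟨Nat.le_succ k, le_rfl, fun i hi' => ?_, h'.step, fun i hi' => ?_⟩
  · rcases Nat.lt_succ_iff_lt_or_eq.mp hi' with hlt | rfl
    · exact h'.sq_ne i hlt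
    · simpa using hs
  · rcases Nat.lt_succ_iff_lt_or_eq.mp hi' with hlt | rfl
    · exact h'.indep i hlt
    · change _ ∉ pathSpan _ i
      rw [pathSpan_congr e]
      simpa using hi

theorem snoc (h : IsPath x (k + 1) (k + 1)) {p : G} (hp : p * p ≠ 1)
    (hs : p * (x k)⁻¹ * (p * (x k)⁻¹) ≠ 1) (hi : charVec p ∉ pathSpan x (k + 1)) :
    IsPath (Function.update x (k + 1) p) (k + 2) (k + 2) := by
  have h' := h.addVertex hp hi
  refine ⟨le_rfl, Nat.le_succ _, h'.sq_ne, fun i hi' => ?_, h'.indep⟩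
  rcases Nat.lt_succ_iff_lt_or_eq.mp hi' with hlt | e
  · exact h'.step i hlt
  · obtain rfl : i = k := by omega
    simpa [Function.update_of_ne] using hs

theorem lt_card [Finite G] (h : IsPath x k k) : k ≤ Nat.card G := by
  have hinj : Function.Injective fun i : Fin k => x i := by
    intro i j e
    exact Fin.ext (h.vertex_inj i.2 j.2 (congrArg charVec e))
  simpa using Nat.card_le_card_of_injective _ hinj

end IsPath

/-- The sequence starting with three given terms. -/
def seqThree (a b c : G) : ℕ → G := fun i => if i = 0 then a else if i = 1 then b else c

theorem pathSpan_seqThree_two (a b c : G) :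
    pathSpan (seqThree a b c) 2 = Submodule.span (ZMod 2) {charVec a, charVec b} :=
  pathSpan_two _

theorem pathSpan_seqThree_three (a b c : G) :
    pathSpan (seqThree a b c) 3 = Submodule.span (ZMod 2) {charVec a, charVec b} ⊔
      Submodule.span (ZMod 2) {charVec c} := by
  rw [pathSpan_succ, pathSpan_seqThree_two]; rfl

theorem isPath_seqThree_two {a b : G} (c : G) (ha : a * a ≠ 1) (hb : b * b ≠ 1)
    (hab : b * a⁻¹ * (b * a⁻¹) ≠ 1) (ia : charVec a ≠ 0) (ib : charVec b ≠ 0)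
    (iab : charVec b ≠ charVec a) : IsPath (seqThree a b c) 2 2 where
  le := le_rfl
  le_succ := Nat.le_succ _
  sq_ne i hi := by
    interval_cases i
    · exact ha
    · exact hb
  step i hi := by
    obtain rfl : i = 0 := by omega
    exact hab
  indep i hi := by
    change _ ∉ pathSpan _ _
    interval_cases i
    · rw [pathSpan_zero]; exact ia
    · rw [pathSpan_succ, pathSpan_zero, bot_sup_eq, zmod_two_mem_span_singleton]
      exact not_or.mpr ⟨ib, iab⟩

theorem isPath_seqThree {a b c : G} (ha : a * a ≠ 1) (hb : b * b ≠ 1) (hc : c * c ≠ 1)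
    (hab : b * a⁻¹ * (b * a⁻¹) ≠ 1) (hbc : c * b⁻¹ * (c * b⁻¹) ≠ 1) (ia : charVec a ≠ 0)
    (ib : charVec b ≠ 0) (iab : charVec b ≠ charVec a)
    (ic : charVec c ∉ Submodule.span (ZMod 2) {charVec a, charVec b}) :
    IsPath (seqThree a b c) 3 3 := by
  have h := (isPath_seqThree_two c ha hb hab ia ib iab).snoc hc hbc
    (by rw [pathSpan_seqThree_two]; exact ic)
  refine h.congr fun i hi => ?_
  interval_cases i <;> rfl

/-- The non-involutions of `G` lie in no proper subgroup containing the Frattini subgroup. -/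
def SqSpans (G : Type*) [Group G] : Prop :=
  ∀ (W : Submodule (ZMod 2) ((G →* Multiplicative (ZMod 2)) → ZMod 2)) (g : G),
    charVec g ∉ W → ∃ r : G, r * r ≠ 1 ∧ charVec r ∉ W

/-- Adding one element to `W` suffices to span the whole space. -/
def CodimLeOne (W : Submodule (ZMod 2) ((G →* Multiplicative (ZMod 2)) → ZMod 2)) : Prop :=
  ∃ c, ∀ g : G, charVec g ∈ W ⊔ Submodule.span (ZMod 2) {c}

/-- A single isolated non-involution completes the span. It enlarges the connection set, hence
`hfix` covers every path with the same first k terms. -/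
theorem IsPath.admitsORR_of_codimLeOne [Finite G] {x : ℕ → G} {k : ℕ} (h : IsPath x k k)
    (hG : IsPGroup 2 G) (hsq : SqSpans G) (hco : CodimLeOne (pathSpan x k))
    (hfix : ∀ (x' : ℕ → G) (K : ℕ), IsPath x' k K → (∀ i < k, x' i = x i) →
      ∀ i < k, x' i ∈ fixer (pathSet x' k K)) : AdmitsORR G := by
  by_cases hall : ∀ g : G, charVec g ∈ pathSpan x k
  · exact h.admitsORR hG hall (hfix x k h fun _ _ => rfl)
  push Not at hall
  obtain ⟨g, hg⟩ := hall
  obtain ⟨s, hs, hsW⟩ := hsq _ g hg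
  have h' := h.addVertex hs hsW
  have e : ∀ i < k, Function.update x k s i = x i := fun i hi =>
    Function.update_of_ne hi.ne _ _
  refine h'.admitsORR hG ?_ (hfix _ _ h' e)
  intro t
  change _ ∈ pathSpan _ (k + 1)
  rw [pathSpan_succ, pathSpan_congr e, Function.update_self]
  obtain ⟨c, hc⟩ := hco
  have h1 := (zmod_two_mem_sup_span.mp (hc s)).resolve_left hsW
  rw [zmod_two_mem_sup_span]
  refine (zmod_two_mem_sup_span.mp (hc t)).imp_right fun h2 => ?_
  have := add_mem h1 h2
  rwa [add_add_add_comm, zmod_two_add_self, add_zero, add_comm] at this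

end Extension

/-! ### Pairs whose products are involutions. -/

section AntiCommuting

variable {G : Type*} [Group G]

/-- Both `p * b` and `p * b⁻¹` are trivial or involutions. -/
def AntiPair (p b : G) : Prop := p * b * (p * b) = 1 ∧ p * b⁻¹ * (p * b⁻¹) = 1

theorem AntiPair.of_inv {p b : G} (h : p * b * (p * b) = 1)
    (h' : p⁻¹ * b * (p⁻¹ * b) = 1) : AntiPair p b := by
  refine ⟨h, ?_⟩
  have h1 : b⁻¹ * p * (b⁻¹ * p) = 1 := by
    rw [← inv_inj, inv_one, ← h']; group
  calc p * b⁻¹ * (p * b⁻¹) = b * (b⁻¹ * p * (b⁻¹ * p)) * b⁻¹ := by group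
    _ = 1 := by rw [h1]; group

theorem AntiPair.of_inv' {p b : G} (h : p * b⁻¹ * (p * b⁻¹) = 1)
    (h' : p⁻¹ * b⁻¹ * (p⁻¹ * b⁻¹) = 1) : AntiPair p b := by
  have := AntiPair.of_inv h h'
  exact ⟨by simpa using this.2, this.1⟩

theorem AntiPair.mul_mul {p b : G} (h : AntiPair p b) : p * b * p = b⁻¹ := by
  rw [eq_inv_iff_mul_eq_one, ← h.1]; group

theorem AntiPair.mul_inv_mul {p b : G} (h : AntiPair p b) : p * b⁻¹ * p = b := by
  rw [← mul_inv_eq_one, ← h.2]; group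

theorem AntiPair.inverts_sq_inv {p b : G} (h : AntiPair p b) : b * (p * p)⁻¹ * b⁻¹ = p * p := by
  have h1 : b⁻¹ = p * p * b⁻¹ * (p * p) := by
    nth_rw 1 [← h.mul_mul, ← h.mul_inv_mul]; group
  have h2 : (p * p)⁻¹ * b⁻¹ = b⁻¹ * (p * p) := by
    nth_rw 1 [h1]; group
  rw [mul_assoc, h2]; group

theorem AntiPair.inverts_sq {p b : G} (h : AntiPair p b) : b * (p * p) * b⁻¹ = (p * p)⁻¹ := by
  calc b * (p * p) * b⁻¹ = (b * (p * p)⁻¹ * b⁻¹)⁻¹ := by simp [mul_assoc]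
    _ = (p * p)⁻¹ := by rw [h.inverts_sq_inv]

/-- What matters is that the right-hand side is independent of p. -/
theorem AntiPair.conj {p a b : G} (hb : AntiPair p b) (hy : AntiPair p (b * a⁻¹)) :
    p * a * p⁻¹ = b * a⁻¹ * b⁻¹ := by
  have h1 := hb.mul_mul
  have h2 := hy.mul_inv_mul
  have h3 : (p * p)⁻¹ * b⁻¹ = b⁻¹ * (p * p) := by
    nth_rw 2 [← hb.inverts_sq_inv]; group
  calc p * a * p⁻¹ = (p * (b * a⁻¹)⁻¹ * p) * ((p * p)⁻¹ * (p * b * p)) * (p * p)⁻¹ := by group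
    _ = b * a⁻¹ * b⁻¹ := by rw [h2, h1, h3]; group

/-- Each of a, b and b a⁻¹ inverts p². As a is a product of the other two and their inverses it also
centralizes p², so p⁴ = 1. Comparing p a p⁻¹ = a⁻¹ p⁻² with `AntiPair.conj` determines p² from a and
b alone. -/
theorem AntiPair.sq_eq {p a b : G} (hb : AntiPair p b) (hy : AntiPair p (b * a⁻¹))
    (ha : AntiPair p a) :
    p * p = b * a⁻¹ * b⁻¹ * a ∧ p * p * (p * p) = 1 := by
  have h1 := hb.inverts_sq
  have h2 := hy.inverts_sq
  have h3 := ha.inverts_sq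
  have h4 : a * (p * p) * a⁻¹ = p * p := by
    have e : a * (p * p) * a⁻¹ = ((b * a⁻¹)⁻¹ * b * (p * p) * b⁻¹ * (b * a⁻¹)) := by group
    rw [e, mul_assoc (b * a⁻¹)⁻¹, mul_assoc (b * a⁻¹)⁻¹, h1]
    have h2' : (b * a⁻¹)⁻¹ * (p * p)⁻¹ * (b * a⁻¹) = p * p := by
      rw [← h2]; group
    exact h2'
  have h5 : p * p * (p * p) = 1 := by
    rw [h3] at h4
    nth_rw 1 [← h4]; group
  refine ⟨?_, h5⟩
  have h6 := hb.conj hy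
  have h7 : p * a * p⁻¹ = a⁻¹ * (p * p)⁻¹ := by
    rw [← ha.mul_mul]; group
  rw [h7] at h6
  have h8 : (p * p)⁻¹ = p * p := inv_eq_of_mul_eq_one_right h5
  rw [← h6, h8]
  calc p * p = a⁻¹ * (a * (p * p) * a⁻¹) * a := by group
    _ = a⁻¹ * (p * p) * a := by rw [h4]

end AntiCommuting

/-! ### Groups in which all squares lie in {1, z}. -/

section Squares

variable {G : Type*} [Group G]

/-- There is no element `z` such that all squares lie in `{1, z}`. -/
def ManySquares (G : Type*) [Group G] : Prop := ∀ z : G, ∃ x : G, x * x ≠ 1 ∧ x * x ≠ z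

theorem exists_hom_ker_pair {z : G} (hz : ∀ g, Commute z g) (hzz : z * z = 1) :
    ∃ N : Subgroup G, N.Normal ∧ ∀ g, g ∈ N ↔ g = 1 ∨ g = z := by
  refine ⟨⟨⟨⟨{g | g = 1 ∨ g = z}, ?_⟩, Or.inl rfl⟩, ?_⟩, ⟨?_⟩, fun g => Iff.rfl⟩
  · rintro a b (rfl | rfl) (rfl | rfl) <;> simp [hzz]
  · rintro a (rfl | rfl)
    · simp
    · exact Or.inr (inv_eq_of_mul_eq_one_right hzz)
  · rintro n (rfl | rfl) g
    · left; simp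
    · right; rw [← (hz g).eq, mul_inv_cancel_right]

theorem sq_eq_one_of_closure {X : Set G} (hX : Subgroup.closure X = ⊤)
    (hsq : ∀ x ∈ X, x * x = 1) (hcomm : ∀ x ∈ X, ∀ y ∈ X, Commute x y) (g : G) : g * g = 1 := by
  have hcen : ∀ x ∈ X, ∀ g, Commute x g := by
    intro x hx g
    have hg : g ∈ Subgroup.closure X := hX ▸ Subgroup.mem_top g
    induction hg using Subgroup.closure_induction with
    | mem y hy => exact hcomm x hx y hy
    | one => exact Commute.one_right x
    | mul a b _ _ ha hb => exact ha.mul_right hb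
    | inv a _ ha => exact ha.inv_right
  have hg : g ∈ Subgroup.closure X := hX ▸ Subgroup.mem_top g
  have h : g * g = 1 ∧ ∀ w, Commute g w := by
    induction hg using Subgroup.closure_induction with
    | mem y hy => exact ⟨hsq y hy, hcen y hy⟩
    | one => exact ⟨one_mul 1, fun w => Commute.one_left w⟩
    | mul a b _ _ ha hb =>
      exact ⟨by rw [mul_assoc, ← mul_assoc b, (hb.2 a).eq, mul_assoc a, hb.1, mul_one, ha.1],
        fun w => (ha.2 w).mul_left (hb.2 w)⟩
    | inv a _ ha => exact ⟨by rw [← mul_inv_rev, ha.1, inv_one], fun w => (ha.2 w).inv_left⟩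
  exact h.1

/-- If `G` is generated by elements that commute and are involutions modulo the central subgroup
`{1, z}`, then all squares of `G` lie in `{1, z}`. -/
theorem sq_of_closure {z : G} (hz : ∀ g, Commute z g) (hzz : z * z = 1) {X : Set G}
    (hX : Subgroup.closure X = ⊤) (hsq : ∀ x ∈ X, x * x = 1 ∨ x * x = z)
    (hcomm : ∀ x ∈ X, ∀ y ∈ X, x * y = y * x ∨ x * y = y * x * z) (g : G) :
    g * g = 1 ∨ g * g = z := by
  obtain ⟨N, hN, hmem⟩ := exists_hom_ker_pair hz hzz
  rw [← hmem, ← QuotientGroup.eq_one_iff, QuotientGroup.mk_mul]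
  refine sq_eq_one_of_closure (X := (QuotientGroup.mk' N) '' X) ?_ ?_ ?_ _
  · rw [← MonoidHom.map_closure, hX, ← MonoidHom.range_eq_map]
    exact MonoidHom.range_eq_top.mpr (QuotientGroup.mk'_surjective N)
  · rintro _ ⟨x, hx, rfl⟩
    rw [← map_mul, QuotientGroup.mk'_apply, QuotientGroup.eq_one_iff, hmem]
    exact hsq x hx
  · rintro _ ⟨x, hx, rfl⟩ _ ⟨y, hy, rfl⟩
    change _ = _
    rw [← map_mul, ← map_mul, QuotientGroup.mk'_apply, QuotientGroup.mk'_apply, eq_comm,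
      QuotientGroup.eq, hmem]
    rcases hcomm x hx y hy with h | h
    · left; rw [h]; group
    · right; rw [h]; group

variable {L : Submodule (ZMod 2) ((G →* Multiplicative (ZMod 2)) → ZMod 2)} {z : G}

theorem charVec_mul_mem_iff {a b : G} (ha : charVec a ∈ L) :
    charVec (a * b) ∈ L ↔ charVec b ∈ L := by
  rw [charVec_mul]; exact L.add_mem_iff_right ha

theorem charVec_mul_mem_iff' {a b : G} (hb : charVec b ∈ L) :
    charVec (a * b) ∈ L ↔ charVec a ∈ L := by
  rw [charVec_mul]; exact L.add_mem_iff_left hb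

theorem charVec_sq (p : G) : charVec (p * p) = 0 := by
  rw [charVec_mul, zmod_two_add_self]

/-- If the squares of all elements outside `L` lie in `{1, z}`, then `z` is central. -/
theorem commute_of_sq_outside (hz1 : z ≠ 1) (hzz : z * z = 1) (hzL : charVec z ∈ L)
    (hsq : ∀ q, charVec q ∉ L → q * q = 1 ∨ q * q = z) {q : G} (hq : charVec q ∉ L) (g : G) :
    Commute z g := by
  have hout : ∀ q, charVec q ∉ L → Commute z q := by
    intro q hq
    rcases hsq q hq with h | h
    · rcases hsq (q * z) (by rwa [charVec_mul_mem_iff' hzL]) with h' | h'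
      · have e1 : q⁻¹ = q := inv_eq_of_mul_eq_one_right h
        have e2 : z⁻¹ = z := inv_eq_of_mul_eq_one_right hzz
        have e3 : q * z = z⁻¹ * q⁻¹ := by
          rw [← mul_inv_rev, eq_inv_iff_mul_eq_one, h']
        rw [e1, e2] at e3
        exact e3.symm
      · exfalso
        apply hz1
        have e : q * z * q = 1 := by
          have : q * z * q * z = 1 * z := by rw [one_mul, ← mul_assoc] at *; exact h'
          exact mul_right_cancel this
        calc z = q⁻¹ * (q * z * q) * q * (q * q)⁻¹ := by group
          _ = 1 := by rw [e, h]; group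
    · rw [← h]; exact (Commute.refl q).mul_left (Commute.refl q)
  by_cases hg : charVec g ∈ L
  · have h1 := hout (g * q) (by rwa [charVec_mul_mem_iff hg])
    have h2 := h1.mul_right (hout q hq).inv_right
    simpa using h2
  · exact hout g hg

/-- The involutions w, w' and w w' all invert l; but w w', as a product of two inverting elements,
also centralizes l. -/
theorem sq_eq_one_of_inverted {Q : Type*} [Group Q] {w w' l : Q} (hw : w * w = 1)
    (hw' : w' * w' = 1) (hww : w * w' * (w * w') = 1) (h : w * l * (w * l) = 1)
    (h' : w' * l * (w' * l) = 1) (h'' : w * w' * l * (w * w' * l) = 1) : l * l = 1 := by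
  have i1 : w⁻¹ = w := inv_eq_of_mul_eq_one_right hw
  have i2 : w'⁻¹ = w' := inv_eq_of_mul_eq_one_right hw'
  have c : w * w' = w' * w := by
    have := inv_eq_of_mul_eq_one_right hww
    rw [mul_inv_rev, i1, i2] at this
    exact this.symm
  have e1 : w * l * w = l⁻¹ := by rw [eq_inv_iff_mul_eq_one, ← h]; group
  have e2 : w' * l * w' = l⁻¹ := by rw [eq_inv_iff_mul_eq_one, ← h']; group
  have e3 : w * w' * l * (w * w') = l⁻¹ := by rw [eq_inv_iff_mul_eq_one, ← h'']; group
  have e4 : w' * l⁻¹ * w' = l := by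
    rw [← inv_inj, mul_inv_rev, mul_inv_rev, i2, inv_inv, ← mul_assoc, e2]
  have e5 : w * w' * l * (w * w') = w' * (w * l * w) * w' := by
    rw [c]
    nth_rw 2 [← c]
    group
  rw [e5, e1, e4] at e3
  nth_rw 2 [e3]
  exact mul_inv_cancel l

/-- If the squares of all elements outside a subspace of codimension at least two lie in
`{1, z}`, then all squares do. -/
theorem sq_of_sq_outside (hz : ∀ g, Commute z g) (hzz : z * z = 1)
    (hsq : ∀ q, charVec q ∉ L → q * q = 1 ∨ q * q = z) (hco : ¬ CodimLeOne L) (g : G) :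
    g * g = 1 ∨ g * g = z := by
  by_cases hg : charVec g ∈ L
  swap
  · exact hsq g hg
  obtain ⟨N, hN, hmem⟩ := exists_hom_ker_pair hz hzz
  have hq : ∀ q, charVec q ∉ L → (q : G ⧸ N) * q = 1 := by
    intro q hq
    rw [← QuotientGroup.mk_mul, QuotientGroup.eq_one_iff, hmem]
    exact hsq q hq
  unfold CodimLeOne at hco
  push Not at hco
  -- Codimension at least two provides w, w' with w, w' and w w' all outside L; modulo {1, z} each
  -- inverts every element of L.
  obtain ⟨w, hw⟩ := hco 0
  rw [Submodule.span_zero_singleton, sup_bot_eq] at hw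
  obtain ⟨w', hw'⟩ := hco (charVec w)
  rw [zmod_two_mem_sup_span, not_or] at hw'
  have hww : charVec (w * w') ∉ L := by
    rw [charVec_mul, add_comm]; exact hw'.2
  rw [← hmem, ← QuotientGroup.eq_one_iff, QuotientGroup.mk_mul]
  refine sq_eq_one_of_inverted (hq w hw) (hq w' hw'.1) (hq (w * w') hww) ?_ ?_ ?_
  · exact hq (w * g) (by rwa [charVec_mul_mem_iff' hg])
  · exact hq (w' * g) (by rw [charVec_mul_mem_iff' hg]; exact hw'.1)
  · exact hq (w * w' * g) (by rwa [charVec_mul_mem_iff' hg])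

/-- If the squares of all elements outside `L` lie in `{1, z}`, and `G` is generated by elements
of `L` with squares in `{1, z}` together with one further element, then all squares of `G` lie in
`{1, z}`. -/
theorem sq_of_sq_outside_of_closure (hz : ∀ g, Commute z g) (hzz : z * z = 1)
    (hsq : ∀ q, charVec q ∉ L → q * q = 1 ∨ q * q = z) {p : G} (hp : charVec p ∉ L) {Y : Set G}
    (hY : ∀ y ∈ Y, charVec y ∈ L ∧ (y * y = 1 ∨ y * y = z))
    (hgen : Subgroup.closure (insert p Y) = ⊤) (g : G) : g * g = 1 ∨ g * g = z := by
  obtain ⟨N, hN, hmem⟩ := exists_hom_ker_pair hz hzz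
  have hq : ∀ q, charVec q ∉ L → (q : G ⧸ N) * q = 1 := by
    intro q hq
    rw [← QuotientGroup.mk_mul, QuotientGroup.eq_one_iff, hmem]
    exact hsq q hq
  -- Modulo {1, z} the element p inverts all of L. Elements of Y are their own inverses there, so
  -- they commute with p, and inverting their products shows that they commute with each other.
  have hinv : ∀ l : G, charVec l ∈ L → (p : G ⧸ N) * l * p = (l : G ⧸ N)⁻¹ := by
    intro l hl
    have := hq (p * l) (by rwa [charVec_mul_mem_iff' hl])
    rw [QuotientGroup.mk_mul] at this
    rw [eq_inv_iff_mul_eq_one, ← this]; group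
  have hpp := hq p hp
  have hYsq : ∀ y ∈ Y, (y : G ⧸ N) * y = 1 := by
    intro y hy
    rw [← QuotientGroup.mk_mul, QuotientGroup.eq_one_iff, hmem]
    exact (hY y hy).2
  have hpy : ∀ y ∈ Y, Commute (p : G ⧸ N) y := by
    intro y hy
    have h1 := hinv y (hY y hy).1
    rw [inv_eq_of_mul_eq_one_right (hYsq y hy)] at h1
    change _ = _
    nth_rw 2 [← h1]
    rw [mul_assoc, hpp, mul_one]
  have hyy : ∀ y ∈ Y, ∀ y' ∈ Y, Commute (y : G ⧸ N) y' := by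
    intro y hy y' hy'
    have h1 := hinv (y * y') (by
      rw [charVec_mul_mem_iff (hY y hy).1]; exact (hY y' hy').1)
    rw [QuotientGroup.mk_mul, mul_inv_rev, inv_eq_of_mul_eq_one_right (hYsq y hy),
      inv_eq_of_mul_eq_one_right (hYsq y' hy'), ((hpy y hy).mul_right (hpy y' hy')).eq,
      mul_assoc, hpp, mul_one] at h1
    exact h1
  rw [← hmem, ← QuotientGroup.eq_one_iff, QuotientGroup.mk_mul]
  refine sq_eq_one_of_closure (X := (QuotientGroup.mk' N) '' (insert p Y)) ?_ ?_ ?_ _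
  · rw [← MonoidHom.map_closure, hgen, ← MonoidHom.range_eq_map]
    exact MonoidHom.range_eq_top.mpr (QuotientGroup.mk'_surjective N)
  · rintro _ ⟨x, hx | hx, rfl⟩
    · rw [hx]; exact hpp
    · exact hYsq x hx
  · rintro _ ⟨x, hx | hx, rfl⟩ _ ⟨y, hy | hy, rfl⟩
    · rw [hx, hy]
    · rw [hx]; exact hpy y hy
    · rw [hy]; exact (hpy x hx).symm
    · exact hyy x hx y hy

/-- A path segment `a, b` can be extended, after changing `b`, if its span together with the
previous vertices has codimension at least two. -/
theorem exists_extension (hsq : SqSpans G) (hmany : ManySquares G)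
    {W : Submodule (ZMod 2) ((G →* Multiplicative (ZMod 2)) → ZMod 2)} {a b : G}
    (ha : a * a ≠ 1) (haW : charVec a ∈ W) (hb : b * b ≠ 1)
    (hy : b * a⁻¹ * (b * a⁻¹) ≠ 1) (hbW : charVec b ∉ W)
    (hco : ¬ CodimLeOne (W ⊔ Submodule.span (ZMod 2) {charVec b})) :
    ∃ b' p : G, b' * b' ≠ 1 ∧ b' * a⁻¹ * (b' * a⁻¹) ≠ 1 ∧ charVec b' ∉ W ∧ p * p ≠ 1 ∧
      p * b'⁻¹ * (p * b'⁻¹) ≠ 1 ∧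
      charVec p ∉ W ⊔ Submodule.span (ZMod 2) {charVec b'} := by
  by_contra hno
  have hno' : ∀ b' p : G, b' * b' ≠ 1 → b' * a⁻¹ * (b' * a⁻¹) ≠ 1 → charVec b' ∉ W →
      p * p ≠ 1 → charVec p ∉ W ⊔ Submodule.span (ZMod 2) {charVec b'} →
      p * b'⁻¹ * (p * b'⁻¹) = 1 := by
    intro b' p h1 h2 h3 h4 h5
    by_contra h6
    exact hno ⟨b', p, h1, h2, h3, h4, h6, h5⟩
  clear hno
  have hanti : ∀ b' p : G, b' * b' ≠ 1 → b' * a⁻¹ * (b' * a⁻¹) ≠ 1 → charVec b' ∉ W →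
      p * p ≠ 1 → charVec p ∉ W ⊔ Submodule.span (ZMod 2) {charVec b'} → AntiPair p b' := by
    intro b' p h1 h2 h3 h4 h5
    refine AntiPair.of_inv' (hno' b' p h1 h2 h3 h4 h5) (hno' b' p⁻¹ h1 h2 h3 ?_ (by simpa using h5))
    rw [← mul_inv_rev, inv_ne_one]; exact h4
  have hantiy : ∀ b' p : G, b' * b' ≠ 1 → b' * a⁻¹ * (b' * a⁻¹) ≠ 1 → charVec b' ∉ W →
      p * p ≠ 1 → charVec p ∉ W ⊔ Submodule.span (ZMod 2) {charVec b'} →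
      AntiPair p (b' * a⁻¹) := by
    intro b' p h1 h2 h3 h4 h5
    -- The element a b'⁻¹ is an admissible replacement for b': its quotient by a is conjugate to
    -- b'⁻¹, and it spans the same space together with W.
    have key : AntiPair p (b' * a⁻¹)⁻¹ := by
      refine hanti (b' * a⁻¹)⁻¹ p ?_ ?_ ?_ h4 ?_
      · rw [← mul_inv_rev, inv_ne_one]; exact h2
      · intro h
        apply h1
        calc b' * b' = (a⁻¹ * ((b' * a⁻¹)⁻¹ * a⁻¹ * ((b' * a⁻¹)⁻¹ * a⁻¹)) * a)⁻¹ := by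
              simp [mul_assoc]
          _ = 1 := by rw [h]; group
      · simpa [W.add_mem_iff_right haW] using h3
      · intro h
        apply h5
        rw [zmod_two_mem_sup_span] at h ⊢
        refine h.imp_right fun h => ?_
        simp only [charVec_inv, charVec_mul, ← add_assoc] at h
        exact (W.add_mem_iff_left haW).mp h
    exact ⟨by simpa using key.2, key.1⟩
  have hne : charVec b ∉ W := hbW
  have hP : ∀ p : G, p * p ≠ 1 → charVec p ∉ W ⊔ Submodule.span (ZMod 2) {charVec b} →
      AntiPair p a := by
    intro p hp hpL
    have hconj : ∀ b' p : G, b' * b' ≠ 1 → b' * a⁻¹ * (b' * a⁻¹) ≠ 1 → charVec b' ∉ W →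
      p * p ≠ 1 → charVec p ∉ W ⊔ Submodule.span (ZMod 2) {charVec b'} →
      p * a * p⁻¹ = b' * a⁻¹ * b'⁻¹ := fun b' p h1 h2 h3 h4 h5 =>
        (hanti b' p h1 h2 h3 h4 h5).conj (hantiy b' p h1 h2 h3 h4 h5)
    have key : ∀ p : G, p * p ≠ 1 → charVec p ∉ W ⊔ Submodule.span (ZMod 2) {charVec b} →
        p * a⁻¹ * (p * a⁻¹) = 1 := by
      intro p hp hpL
      by_contra hpa
      have hpW : charVec p ∉ W := fun h => hpL (Submodule.mem_sup_left h)
      -- Now p itself could replace b. For r outside the span of W, b and p, the formulas for r a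
      -- r⁻¹ and p a p⁻¹ combine to a = a⁻¹.
      obtain ⟨g, hg⟩ : ∃ g : G, charVec g ∉ W ⊔ Submodule.span (ZMod 2) {charVec b} ⊔
          Submodule.span (ZMod 2) {charVec p} := by
        unfold CodimLeOne at hco
        push Not at hco
        exact hco _
      obtain ⟨r, hr, hrL⟩ := hsq _ g hg
      have e1 := hconj b r hb hy hbW hr fun h => hrL (Submodule.mem_sup_left h)
      have hle : W ⊔ Submodule.span (ZMod 2) {charVec p} ≤
          W ⊔ Submodule.span (ZMod 2) {charVec b} ⊔ Submodule.span (ZMod 2) {charVec p} :=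
        sup_le_sup_right le_sup_left _
      have e2 := hconj p r hp hpa hpW hr fun h => hrL (hle h)
      have e3 := hconj b p hb hy hbW hp hpL
      rw [← e1, e2] at e3
      apply ha
      have e4 : a = a⁻¹ := by
        have := mul_left_cancel (mul_right_cancel e3)
        exact this
      nth_rw 1 [e4]
      exact inv_mul_cancel a
    refine AntiPair.of_inv' (key p hp hpL) (key p⁻¹ ?_ (by simpa using hpL))
    rw [← mul_inv_rev, inv_ne_one]; exact hp
  have hPz : ∀ p : G, p * p ≠ 1 → charVec p ∉ W ⊔ Submodule.span (ZMod 2) {charVec b} →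
      p * p = b * a⁻¹ * b⁻¹ * a ∧ p * p * (p * p) = 1 := fun p hp hpL =>
    (hanti b p hb hy hbW hp hpL).sq_eq (hantiy b p hb hy hbW hp hpL) (hP p hp hpL)
  obtain ⟨p, hp, hpL⟩ : ∃ p : G, p * p ≠ 1 ∧
      charVec p ∉ W ⊔ Submodule.span (ZMod 2) {charVec b} := by
    by_contra hall
    apply hco
    refine ⟨0, fun g => ?_⟩
    rw [Submodule.span_zero_singleton, sup_bot_eq]
    by_contra hg
    obtain ⟨r, hr, hrL⟩ := hsq _ g hg
    exact hall ⟨r, hr, hrL⟩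
  have hout : ∀ q, charVec q ∉ W ⊔ Submodule.span (ZMod 2) {charVec b} →
      q * q = 1 ∨ q * q = p * p := by
    intro q hq
    by_cases h : q * q = 1
    · exact Or.inl h
    · right; rw [(hPz q h hq).1, (hPz p hp hpL).1]
  have hzz := (hPz p hp hpL).2
  have hz := commute_of_sq_outside hp hzz (by rw [charVec_sq]; exact zero_mem _) hout hpL
  obtain ⟨x, hx1, hx2⟩ := hmany (p * p)
  rcases sq_of_sq_outside hz hzz hout hco x with h | h
  · exact hx1 h
  · exact hx2 h

end Squares

/-! ### Growing a path from a noncommuting edge. -/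

section Selection

variable {G : Type*} [Group G]

theorem CodimLeOne.mem_sup {W : Submodule (ZMod 2) ((G →* Multiplicative (ZMod 2)) → ZMod 2)}
    (hco : CodimLeOne W) {p : G} (hp : charVec p ∉ W) (g : G) :
    charVec g ∈ W ⊔ Submodule.span (ZMod 2) {charVec p} := by
  obtain ⟨c, hc⟩ := hco
  have h1 := (zmod_two_mem_sup_span.mp (hc p)).resolve_left hp
  rw [zmod_two_mem_sup_span]
  refine (zmod_two_mem_sup_span.mp (hc g)).imp_right fun h2 => ?_
  have := add_mem h1 h2
  rwa [add_add_add_comm, zmod_two_add_self, add_zero, add_comm] at this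

theorem pathSpan_two_eq (x : ℕ → G) :
    pathSpan x 2 = Submodule.span (ZMod 2) (charVec '' {x 0, x 1}) := by
  rw [pathSpan_two, Set.image_pair]

theorem pathSpan_three_eq (x : ℕ → G) :
    pathSpan x 3 = Submodule.span (ZMod 2) (charVec '' {x 0, x 1, x 2}) := by
  rw [pathSpan_succ, pathSpan_two, ← Submodule.span_union, Set.image_insert_eq, Set.image_pair]
  congr 1
  ext v
  simp only [Set.mem_union, Set.mem_insert_iff, Set.mem_singleton_iff, or_assoc]

theorem pathSpan_seqThree_image (a b c : G) :
    pathSpan (seqThree a b c) 3 = Submodule.span (ZMod 2) (charVec '' {a, b, c}) :=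
  pathSpan_three_eq _

/-- Conjugation by b inverts a but fixes a² = b², so a⁴ = 1: the relations of the quaternion group.
-/
theorem quaternion_pair {a b : G} (hs : a * a = b * b) (hb : b * a⁻¹ = a * b) :
    a * a * (a * a) = 1 ∧ b * a = a * b * (a * a) ∧ a * b = b * a * (a * a) := by
  have e0 : b * a⁻¹ * b⁻¹ = a := by rw [hb, mul_inv_cancel_right]
  have e1 : b * a * b⁻¹ = a⁻¹ := by
    calc b * a * b⁻¹ = (b * a⁻¹ * b⁻¹)⁻¹ := by simp [mul_assoc]
      _ = a⁻¹ := by rw [e0]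
  have e2 : a⁻¹ * a⁻¹ = a * a := by
    calc a⁻¹ * a⁻¹ = (b * a * b⁻¹) * (b * a * b⁻¹) := by rw [e1]
      _ = b * (a * a) * b⁻¹ := by group
      _ = a * a := by rw [hs]; group
  have e3 : a * a * (a * a) = 1 := by
    nth_rw 1 [← e2]; group
  refine ⟨e3, ?_, ?_⟩
  · rw [← hb]; group
  · have e4 : b * a * (a * a) = b * a⁻¹ * (a * a * (a * a)) := by group
    rw [e4, e3, mul_one, hb]

/-- Only the last old vertex may be altered, so k ≥ 3 protects the first edge. -/
theorem IsPath.extend {x : ℕ → G} {k : ℕ} (h : IsPath x k k) (hk : 3 ≤ k) (hsq : SqSpans G)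
    (hmany : ManySquares G) (hco : ¬ CodimLeOne (pathSpan x k)) :
    ∃ x', IsPath x' (k + 1) (k + 1) ∧ x' 0 = x 0 ∧ x' 1 = x 1 := by
  obtain ⟨n, rfl⟩ : ∃ n, k = n + 3 := ⟨k - 3, by omega⟩
  rw [pathSpan_succ] at hco
  obtain ⟨b', p, h1, h2, h3, h4, h5, h6⟩ := exists_extension hsq hmany
    (W := pathSpan x (n + 2)) (a := x (n + 1)) (b := x (n + 2)) (h.sq_ne _ (by omega))
    (charVec_mem_pathSpan x (by omega)) (h.sq_ne _ (by omega)) (h.step _ (by omega))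
    (h.indep' (by omega)) hco
  have hx1 := (h.initial (j := n + 2) (by omega)).snoc h1 h2 h3
  have e : ∀ i < n + 2, x i = Function.update x (n + 2) b' i := fun i hi =>
    (Function.update_of_ne hi.ne _ _).symm
  have hx2 := hx1.snoc (p := p) h4 (by simpa using h5) (by
    rw [pathSpan_succ, ← pathSpan_congr e, Function.update_self]; exact h6)
  refine ⟨_, hx2, ?_, ?_⟩ <;>
    rw [Function.update_of_ne (by omega), Function.update_of_ne (by omega)]

theorem sq_inv_ne {b c : G} (h : b * c⁻¹ * (b * c⁻¹) ≠ 1) : c * b⁻¹ * (c * b⁻¹) ≠ 1 := by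
  intro h'
  apply h
  rw [← inv_inj, inv_one, ← h']; group

variable [Finite G]

theorem false_of_sq_inside (hG : IsPGroup 2 G) (hmany : ManySquares G) {Y : Set G} {z : G}
    (hz : ∀ y ∈ Y, Commute z y) (hzz : z * z = 1) (hY : ∀ y ∈ Y, y * y = 1 ∨ y * y = z)
    (hcomm : ∀ x ∈ Y, ∀ y ∈ Y, x * y = y * x ∨ x * y = y * x * z)
    (hall : ∀ g : G, charVec g ∈ Submodule.span (ZMod 2) (charVec '' Y)) : False := by
  have hgen := closure_eq_top_of_charVec hG Y hall
  have hz' : ∀ g, Commute z g := by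
    intro g
    have hg : g ∈ Subgroup.closure Y := hgen ▸ Subgroup.mem_top g
    induction hg using Subgroup.closure_induction with
    | mem y hy => exact hz y hy
    | one => exact Commute.one_right z
    | mul a b _ _ ha hb => exact ha.mul_right hb
    | inv a _ ha => exact ha.inv_right
  obtain ⟨x, hx1, hx2⟩ := hmany z
  exact (sq_of_closure hz' hzz hgen hY hcomm x).elim hx1 hx2

/-- In codimension one the generators `Y` of U must also be controlled; in higher codimension the
squares outside U suffice. -/
theorem false_of_sq_outside (hG : IsPGroup 2 G) (hsq : SqSpans G) (hmany : ManySquares G)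
    {U : Submodule (ZMod 2) ((G →* Multiplicative (ZMod 2)) → ZMod 2)} {z : G} (hzz : z * z = 1)
    (hout : ∀ p, p * p ≠ 1 → charVec p ∉ U → p * p = z) (hex : ∃ g : G, charVec g ∉ U)
    (hY : CodimLeOne U → ∃ Y : Set G, U = Submodule.span (ZMod 2) (charVec '' Y) ∧
      ∀ y ∈ Y, y * y = 1 ∨ y * y = z) : False := by
  obtain ⟨g, hg⟩ := hex
  obtain ⟨p, hp, hpU⟩ := hsq U g hg
  obtain rfl := hout p hp hpU
  have hout' : ∀ q, charVec q ∉ U → q * q = 1 ∨ q * q = p * p := fun q hq =>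
    or_iff_not_imp_left.mpr fun h => hout q h hq
  have hz := commute_of_sq_outside hp hzz (by rw [charVec_sq]; exact zero_mem _) hout' hpU
  obtain ⟨x, hx1, hx2⟩ := hmany (p * p)
  by_cases hco : CodimLeOne U
  · obtain ⟨Y, rfl, hY'⟩ := hY hco
    refine (sq_of_sq_outside_of_closure hz hzz hout' hpU (Y := Y) (fun y hy =>
      ⟨Submodule.subset_span ⟨y, hy, rfl⟩, hY' y hy⟩) ?_ x).elim hx1 hx2
    refine closure_eq_top_of_charVec hG _ fun g => ?_
    rw [Set.image_insert_eq, Submodule.span_insert, sup_comm]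
    exact hco.mem_sup hpU g
  · exact (sq_of_sq_outside hz hzz hout' hco x).elim hx1 hx2

/-- As no noncommuting edge extends, the edges (a, b), (b, a) and (a, a b⁻¹) show that outside
non-involutions are anti to a, b and b a⁻¹, so they share one square. In the quaternion
configuration, where rigidity fails, that square is a², against `hmany`. Otherwise either the
codimension is at most one and the pair is rigid, or `hmany` is violated again. -/
theorem IsPath.admitsORR_of_two {x : ℕ → G} (h : IsPath x 2 2) (hc : ¬ Commute (x 0) (x 1))
    (hG : IsPGroup 2 G) (hsq : SqSpans G) (hmany : ManySquares G)
    (hno : ∀ x : ℕ → G, IsPath x 3 3 → Commute (x 0) (x 1)) : AdmitsORR G := by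
  obtain ⟨a, ha⟩ : ∃ a, a = x 0 := ⟨_, rfl⟩
  obtain ⟨b, hb⟩ : ∃ b, b = x 1 := ⟨_, rfl⟩
  have na : a * a ≠ 1 := ha ▸ h.sq_ne 0 (by omega)
  have nb : b * b ≠ 1 := hb ▸ h.sq_ne 1 (by omega)
  have ny : b * a⁻¹ * (b * a⁻¹) ≠ 1 := by rw [ha, hb]; exact h.step 0 (by omega)
  have hc' : ¬ Commute a b := by rw [ha, hb]; exact hc
  have ia : charVec a ≠ 0 := by
    have := h.indep' (i := 0) (by omega)
    rwa [pathSpan_zero, ← ha] at this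
  have ib : charVec b ≠ 0 ∧ charVec b ≠ charVec a := by
    have := h.indep' (i := 1) (by omega)
    rwa [pathSpan_succ, pathSpan_zero, bot_sup_eq, zmod_two_mem_span_singleton, ← ha, ← hb,
      not_or] at this
  have hU : pathSpan x 2 = Submodule.span (ZMod 2) {charVec a, charVec b} := by
    rw [ha, hb, pathSpan_two]
  have hanti : ∀ u v : G, u * u ≠ 1 → v * v ≠ 1 → v * u⁻¹ * (v * u⁻¹) ≠ 1 → ¬ Commute u v →
      charVec u ≠ 0 → charVec v ≠ 0 → charVec v ≠ charVec u →
      Submodule.span (ZMod 2) {charVec u, charVec v} = pathSpan x 2 →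
      ∀ p, p * p ≠ 1 → charVec p ∉ pathSpan x 2 → AntiPair p v := by
    intro u v nu nv nuv huv iu iv iuv hspan p np hp
    have key : ∀ p, p * p ≠ 1 → charVec p ∉ pathSpan x 2 → p * v⁻¹ * (p * v⁻¹) = 1 := by
      intro p np hp
      by_contra hpv
      exact huv (hno _ (isPath_seqThree nu nv np nuv hpv iu iv iuv (hspan ▸ hp)))
    refine AntiPair.of_inv' (key p np hp) (key p⁻¹ ?_ (by simpa using hp))
    rw [← mul_inv_rev, inv_ne_one]; exact np
  have ny' : a * b⁻¹ * (a * b⁻¹) ≠ 1 := by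
    intro h
    apply ny
    rw [← inv_inj, inv_one, ← h]; group
  have antib := hanti a b na nb ny hc' ia ib.1 ib.2 hU.symm
  have antia := hanti b a nb na ny' (fun h => hc' h.symm) ib.1 ia ib.2.symm
    (by rw [hU, Set.pair_comm])
  have antiy : ∀ p, p * p ≠ 1 → charVec p ∉ pathSpan x 2 → AntiPair p (b * a⁻¹) := by
    intro p np hp
    have := hanti a (a * b⁻¹) na ny' ?_ ?_ ia ?_ ?_ ?_ p np hp
    · have h1 : (a * b⁻¹)⁻¹ = b * a⁻¹ := by group
      have h2 : (b * a⁻¹)⁻¹ = a * b⁻¹ := by group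
      exact ⟨h1 ▸ this.2, by rw [h2]; exact this.1⟩
    · intro h
      apply nb
      calc b * b = (a⁻¹ * (a * b⁻¹ * a⁻¹ * (a * b⁻¹ * a⁻¹)) * a)⁻¹ := by simp [mul_assoc]
        _ = 1 := by rw [h]; group
    · intro h
      apply hc'
      have := (Commute.refl a).inv_right.mul_right h
      simpa using this
    · rw [charVec_mul, charVec_inv]
      intro h
      rw [add_eq_zero_iff_eq_neg, zmod_two_neg] at h
      exact ib.2 h.symm
    · rw [charVec_mul, charVec_inv]
      intro h
      exact ib.1 (add_eq_left.mp h)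
    · rw [hU]
      ext v
      rw [zmod_two_mem_span_pair, zmod_two_mem_span_pair, charVec_mul, charVec_inv, ← add_assoc,
        zmod_two_add_self, zero_add]
      tauto
  have hout : ∀ p, p * p ≠ 1 → charVec p ∉ pathSpan x 2 →
      p * p = b * a⁻¹ * b⁻¹ * a ∧ p * p * (p * p) = 1 := fun p np hp =>
    (antib p np hp).sq_eq (antiy p np hp) (antia p np hp)
  by_cases hQ : a * a = b * b ∧ b * a⁻¹ = a * b
  · exfalso
    obtain ⟨q1, q2, q3⟩ := quaternion_pair hQ.1 hQ.2
    have hYsq : ∀ y ∈ ({a, b} : Set G), y * y = 1 ∨ y * y = a * a := by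
      rintro y (rfl | rfl)
      · exact Or.inr rfl
      · exact Or.inr hQ.1.symm
    by_cases hall : ∀ g : G, charVec g ∈ pathSpan x 2
    · refine false_of_sq_inside hG hmany (Y := {a, b}) (z := a * a) ?_ q1 hYsq ?_ ?_
      · rintro y (rfl | rfl)
        · exact (Commute.refl y).mul_left (Commute.refl y)
        · rw [hQ.1]; exact (Commute.refl y).mul_left (Commute.refl y)
      · rintro u (rfl | rfl) v (rfl | rfl)
        · exact Or.inl rfl
        · exact Or.inr q3
        · exact Or.inr q2
        · exact Or.inl rfl
      · rw [ha, hb, ← pathSpan_two_eq]; exact hall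
    · push Not at hall
      refine false_of_sq_outside hG hsq hmany (U := pathSpan x 2) q1 ?_ hall
        fun _ => ⟨{a, b}, by rw [ha, hb, pathSpan_two_eq], hYsq⟩
      intro p np hp
      rw [(hout p np hp).1, hQ.2, mul_inv_cancel_right]
  · by_cases hco : CodimLeOne (pathSpan x 2)
    · refine h.admitsORR_of_codimLeOne hG hsq hco fun x' K h' e => ?_
      refine h'.fixer_of_eq_two ?_ ?_ <;>
        rw [e 0 (by omega), e 1 (by omega), ← ha, ← hb] <;> assumption
    · exfalso
      have hex : ∃ g : G, charVec g ∉ pathSpan x 2 := by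
        by_contra hall
        push Not at hall
        exact hco ⟨0, fun g => Submodule.mem_sup_left (hall g)⟩
      obtain ⟨g, hg⟩ := hex
      obtain ⟨r, hr, hrU⟩ := hsq _ g hg
      have hz := hout r hr hrU
      refine false_of_sq_outside hG hsq hmany (U := pathSpan x 2) (z := r * r) hz.2 ?_ ⟨g, hg⟩
        fun h => absurd h hco
      intro p np hp
      rw [(hout p np hp).1, hz.1]

theorem IsPath.admitsORR_of_three_of_good {x : ℕ → G} (h : IsPath x 3 3)
    (hc : ¬ Commute (x 0) (x 1)) (hG : IsPGroup 2 G) (hsq : SqSpans G)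
    (hco : CodimLeOne (pathSpan x 3))
    (hgood : ¬ (x 1 * (x 0)⁻¹ = x 0 * x 1 ∧ x 1 * x 1 = x 2 * x 2 ∧
      (x 0 * x 0 = x 1 * x 1 ↔ x 2 * (x 1)⁻¹ = x 1 * x 2))) : AdmitsORR G := by
  refine h.admitsORR_of_codimLeOne hG hsq hco fun x' K h' e => ?_
  refine h'.fixer_of_eq_three ?_ ?_
  · rw [e 0 (by omega), e 1 (by omega)]; exact hc
  · rw [e 0 (by omega), e 1 (by omega), e 2 (by omega)]; exact hgood

-- If neither a, m, c nor its reversal is rigid, then a² = m² = c² and both edges are quaternion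
-- pairs. Then a reordered or modified path is rigid, or all squares lie in {1, m²}.
set_option maxHeartbeats 1000000 in
theorem IsPath.admitsORR_of_three {x : ℕ → G} (h : IsPath x 3 3) (hc : ¬ Commute (x 0) (x 1))
    (hG : IsPGroup 2 G) (hsq : SqSpans G) (hmany : ManySquares G)
    (hno : ∀ x : ℕ → G, IsPath x 4 4 → Commute (x 0) (x 1))
    (hco : CodimLeOne (pathSpan x 3)) : AdmitsORR G := by
  by_contra hORR
  obtain ⟨a, ha⟩ : ∃ a, a = x 0 := ⟨_, rfl⟩
  obtain ⟨m, hm⟩ : ∃ m, m = x 1 := ⟨_, rfl⟩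
  obtain ⟨c, hcc⟩ : ∃ c, c = x 2 := ⟨_, rfl⟩
  have na : a * a ≠ 1 := ha ▸ h.sq_ne 0 (by omega)
  have nm : m * m ≠ 1 := hm ▸ h.sq_ne 1 (by omega)
  have nc : c * c ≠ 1 := hcc ▸ h.sq_ne 2 (by omega)
  have nam : m * a⁻¹ * (m * a⁻¹) ≠ 1 := by rw [ha, hm]; exact h.step 0 (by omega)
  have nmc : c * m⁻¹ * (c * m⁻¹) ≠ 1 := by rw [hcc, hm]; exact h.step 1 (by omega)
  have hcam : ¬ Commute a m := by rw [ha, hm]; exact hc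
  have ia : charVec a ≠ 0 := by
    have := h.indep' (i := 0) (by omega)
    rwa [pathSpan_zero, ← ha] at this
  have im : charVec m ≠ 0 ∧ charVec m ≠ charVec a := by
    have := h.indep' (i := 1) (by omega)
    rwa [pathSpan_succ, pathSpan_zero, bot_sup_eq, zmod_two_mem_span_singleton, ← ha, ← hm,
      not_or] at this
  have ic : charVec c ∉ Submodule.span (ZMod 2) {charVec a, charVec m} := by
    have := h.indep' (i := 2) (by omega)
    rwa [pathSpan_two, ← ha, ← hm, ← hcc] at this
  have ic' := ic
  rw [zmod_two_mem_span_pair, not_or, not_or, not_or] at ic'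
  have hU : pathSpan x 3 = Submodule.span (ZMod 2) {charVec a, charVec m} ⊔
      Submodule.span (ZMod 2) {charVec c} := by
    rw [ha, hm, hcc, pathSpan_succ, pathSpan_two]
  have hUY : pathSpan x 3 = Submodule.span (ZMod 2) (charVec '' {a, m, c}) := by
    rw [ha, hm, hcc, pathSpan_three_eq]
  have hgood := not_not.mp fun hg => hORR (h.admitsORR_of_three_of_good hc hG hsq hco hg)
  rw [← ha, ← hm, ← hcc] at hgood
  obtain ⟨b0, a1, hiff⟩ := hgood
  have hccm : ¬ Commute c m := by
    intro hcm
    exact h.not_commute_of_sq_eq (i := 1) (by omega) (by rw [← hm, ← hcc]; exact a1)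
      (by rw [← hm, ← hcc]; exact hcm.symm)
  have hrev : IsPath (seqThree c m a) 3 3 := by
    refine isPath_seqThree nc nm na (sq_inv_ne nmc) (sq_inv_ne nam) ic'.1 im.1 (Ne.symm ic'.2.2.1) ?_
    rw [zmod_two_mem_span_pair, not_or, not_or, not_or]
    refine ⟨ia, Ne.symm ic'.2.1, Ne.symm im.2, fun e => ic'.2.2.2 ?_⟩
    rw [e, add_assoc, zmod_two_add_self, add_zero]
  have hgood' := not_not.mp fun hg => hORR (hrev.admitsORR_of_three_of_good hccm hG hsq (by
    rw [pathSpan_seqThree_image, show ({c, m, a} : Set G) = {a, m, c} by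
      ext w; simp only [Set.mem_insert_iff, Set.mem_singleton_iff]; tauto, ← hUY]
    exact hco) hg)
  have b0' : m * c⁻¹ = c * m := hgood'.1
  have a1' : m * m = a * a := hgood'.2.1
  have b1 : c * m⁻¹ = m * c := hiff.mp a1'.symm
  obtain ⟨q1, q2, q3⟩ := quaternion_pair a1 b1
  obtain ⟨-, q2', q3'⟩ := quaternion_pair a1'.symm b0
  rw [← a1'] at q2' q3'
  have hYsq : ∀ y ∈ ({a, m, c} : Set G), y * y = 1 ∨ y * y = m * m := by
    rintro y (rfl | rfl | rfl)
    · exact Or.inr a1'.symm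
    · exact Or.inr rfl
    · exact Or.inr a1.symm
  have hzY : ∀ y ∈ ({a, m, c} : Set G), Commute (m * m) y := by
    rintro y (rfl | rfl | rfl)
    · rw [a1']; exact (Commute.refl y).mul_left (Commute.refl y)
    · exact (Commute.refl y).mul_left (Commute.refl y)
    · rw [a1]; exact (Commute.refl y).mul_left (Commute.refl y)
  have ainv : a⁻¹ = a * (m * m) := by
    rw [inv_eq_iff_mul_eq_one, ← mul_assoc, ← a1', q1]
  have cinv : c⁻¹ = c * (m * m) := by
    rw [inv_eq_iff_mul_eq_one, ← mul_assoc, ← a1, q1]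
  by_cases hall : ∀ g : G, charVec g ∈ pathSpan x 3
  · by_cases hac : a * c = c * a ∨ a * c = c * a * (m * m)
    · refine false_of_sq_inside hG hmany (Y := {a, m, c}) (z := m * m) hzY q1 hYsq ?_
        (hUY ▸ hall)
      have hca : c * a = a * c ∨ c * a = a * c * (m * m) := by
        rcases hac with e | e
        · exact Or.inl e.symm
        · right; rw [e, mul_assoc, q1, mul_one]
      rintro u (rfl | rfl | rfl) v (rfl | rfl | rfl)
      · exact Or.inl rfl
      · exact Or.inr q3'
      · exact hac
      · exact Or.inr q2'
      · exact Or.inl rfl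
      · exact Or.inr q3
      · exact hca
      · exact Or.inr q2
      · exact Or.inl rfl
    -- Moving a to the middle works: the configuration excluded for m, a, c would make a and c
    -- commute up to m².
    · rw [not_or] at hac
      have hza := hzY a (by simp)
      have hzc := hzY c (by simp)
      have nca : c * a⁻¹ * (c * a⁻¹) ≠ 1 := by
        intro e
        apply hac.1
        have e1 : c * a⁻¹ = a * c⁻¹ := by
          rw [eq_comm, ← mul_inv_eq_one, ← inv_inj, inv_one, ← e]; group
        rw [ainv, cinv, ← mul_assoc c a (m * m), ← mul_assoc a c (m * m), mul_left_inj] at e1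
        exact e1.symm
      have hp : IsPath (seqThree m a c) 3 3 :=
        isPath_seqThree nm na nc (sq_inv_ne nam) nca im.1 ia (Ne.symm im.2)
          (by rw [Set.pair_comm]; exact ic)
      refine hORR (hp.admitsORR_of_three_of_good (fun e => hcam e.symm) hG hsq (by
        rw [pathSpan_seqThree_image, Set.insert_comm, ← hUY]
        exact hco) ?_)
      rintro ⟨-, -, e⟩
      have e1 : c * a⁻¹ = a * c := e.mp a1'
      apply hac.2
      rw [← e1, ainv, mul_assoc]
  · push Not at hall
    have hanti : ∀ v : G, v * v ≠ 1 → v * m⁻¹ * (v * m⁻¹) ≠ 1 →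
        Submodule.span (ZMod 2) {charVec a, charVec m} ⊔ Submodule.span (ZMod 2) {charVec v} =
          pathSpan x 3 → charVec v ∉ Submodule.span (ZMod 2) {charVec a, charVec m} →
        ∀ p, p * p ≠ 1 → charVec p ∉ pathSpan x 3 → AntiPair p v := by
      intro v nv nmv hspan hv p np hp
      have key : ∀ p, p * p ≠ 1 → charVec p ∉ pathSpan x 3 → p * v⁻¹ * (p * v⁻¹) = 1 := by
        intro p np hp
        by_contra hpv
        have h3 := isPath_seqThree na nm nv nam nmv ia im.1 im.2 hv
        have h4 := h3.snoc (k := 2) np hpv (by rw [pathSpan_seqThree_three, hspan]; exact hp)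
        exact hcam (hno _ h4)
      refine AntiPair.of_inv' (key p np hp) (key p⁻¹ ?_ (by simpa using hp))
      rw [← mul_inv_rev, inv_ne_one]; exact np
    have antic := hanti c nc nmc hU.symm ic
    have antiy : ∀ p, p * p ≠ 1 → charVec p ∉ pathSpan x 3 → AntiPair p (c * m⁻¹) := by
      intro p np hp
      have := hanti (m * c⁻¹) (sq_inv_ne nmc) ?_ ?_ ?_ p np hp
      · have h1 : (m * c⁻¹)⁻¹ = c * m⁻¹ := by group
        have h2 : (c * m⁻¹)⁻¹ = m * c⁻¹ := by group
        exact ⟨h1 ▸ this.2, by rw [h2]; exact this.1⟩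
      · intro h
        apply nc
        calc c * c = (m⁻¹ * (m * c⁻¹ * m⁻¹ * (m * c⁻¹ * m⁻¹)) * m)⁻¹ := by simp [mul_assoc]
          _ = 1 := by rw [h]; group
      · rw [hU]
        ext v
        have hm' : charVec m ∈ Submodule.span (ZMod 2) {charVec a, charVec m} :=
          Submodule.subset_span (by simp)
        rw [zmod_two_mem_sup_span, zmod_two_mem_sup_span, charVec_mul, charVec_inv,
          add_left_comm, Submodule.add_mem_iff_right _ hm']
      · have hm' : charVec m ∈ Submodule.span (ZMod 2) {charVec a, charVec m} :=
          Submodule.subset_span (by simp)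
        rw [charVec_mul, charVec_inv, Submodule.add_mem_iff_right _ hm']
        exact ic
    -- Here `AntiPair.conj` gives p m p⁻¹ = c m⁻¹ c⁻¹, which is m by the quaternion relation.
    have hconj : ∀ p, p * p ≠ 1 → charVec p ∉ pathSpan x 3 → Commute p m := by
      intro p np hp
      have := (antic p np hp).conj (antiy p np hp)
      rw [b1, mul_inv_cancel_right, mul_inv_eq_iff_eq_mul] at this
      exact this
    have key : ∀ p, p * p ≠ 1 → charVec p ∉ pathSpan x 3 → p * m⁻¹ * (p * m⁻¹) = 1 := by
      intro p np hp
      by_contra hpm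
      have hpW : charVec p ∉ Submodule.span (ZMod 2) {charVec a, charVec m} := fun h =>
        hp (hU ▸ Submodule.mem_sup_left h)
      have hp3 : IsPath (seqThree a m p) 3 3 :=
        isPath_seqThree na nm np nam hpm ia im.1 im.2 hpW
      refine hORR (hp3.admitsORR_of_three_of_good hcam hG hsq ⟨charVec c, fun g => ?_⟩ ?_)
      · have := hco.mem_sup hp g
        rw [hU, sup_right_comm] at this
        rw [pathSpan_seqThree_three]
        exact this
      · rintro ⟨-, e, -⟩
        exact hp3.not_commute_of_sq_eq (i := 1) (by omega) e (hconj p np hp).symm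
    refine false_of_sq_outside hG hsq hmany (U := pathSpan x 3) (z := m * m) q1 ?_ hall
      fun _ => ⟨{a, m, c}, hUY, hYsq⟩
    intro p np hp
    have antim : AntiPair p m := by
      refine AntiPair.of_inv' (key p np hp) (key p⁻¹ ?_ (by simpa using hp))
      rw [← mul_inv_rev, inv_ne_one]; exact np
    rw [((antic p np hp).sq_eq (antiy p np hp) antim).1, b1, mul_inv_cancel_right]

/-- A finite `2`-group with a noncommuting path of length two admits an ORR, provided its
non-involutions generate it and its squares do not lie in a set `{1, z}`. -/
theorem IsPath.admitsORR_of_start {x : ℕ → G} (h : IsPath x 2 2) (hc : ¬ Commute (x 0) (x 1))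
    (hG : IsPGroup 2 G) (hsq : SqSpans G) (hmany : ManySquares G) : AdmitsORR G := by
  by_contra hORR
  -- Without an ORR no path gets stuck, so paths would exceed the order of G.
  have hstep : ∀ k, 2 ≤ k → ∃ x : ℕ → G, IsPath x k k ∧ ¬ Commute (x 0) (x 1) := by
    intro k hk
    induction k, hk using Nat.le_induction with
    | base => exact ⟨x, h, hc⟩
    | succ k hk ih =>
      obtain ⟨x, h, hc⟩ := ih
      by_contra hno
      push Not at hno
      rcases Nat.lt_or_ge k 3 with hk3 | hk3
      · obtain rfl : k = 2 := by omega
        exact hORR (h.admitsORR_of_two hc hG hsq hmany hno)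
      by_cases hco : CodimLeOne (pathSpan x k)
      · rcases Nat.lt_or_ge k 4 with hk4 | hk4
        · obtain rfl : k = 3 := by omega
          exact hORR (h.admitsORR_of_three hc hG hsq hmany hno hco)
        · refine hORR (h.admitsORR_of_codimLeOne hG hsq hco fun x' K h' e => ?_)
          refine h'.fixer_of_four_le hk4 ?_
          rw [e 0 (by omega), e 1 (by omega)]; exact hc
      · obtain ⟨x', hx', e0, e1⟩ := h.extend hk3 hsq hmany hco
        have := hno x' hx'
        rw [e0, e1] at this
        exact hc this
  obtain ⟨x, h, -⟩ := hstep (Nat.card G + 2) (by omega)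
  have := h.lt_card
  omega

end Selection

/-! ### Finding a noncommuting edge. -/

section Start

variable {G : Type*} [Group G]

theorem AntiPair.inv_right {p b : G} (h : AntiPair p b) : AntiPair p b⁻¹ :=
  ⟨h.2, by rw [inv_inv]; exact h.1⟩

/-- Conjugation by r inverts a b. Commuting with a b would make a b an involution, and being anti to
it would make r one. -/
theorem AntiPair.mul_right_false {r a b : G} (ha : AntiPair r a) (hb : AntiPair r b)
    (hab : Commute a b) (hr : r * r ≠ 1) (hsq : a * b * (a * b) ≠ 1)
    (h : Commute r (a * b) ∨ AntiPair r (a * b)) : False := by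
  have h1 : r * (a * b) * r⁻¹ = (a * b)⁻¹ := by
    have e : (r * r)⁻¹ * b⁻¹ = b⁻¹ * (r * r) := by
      nth_rw 2 [← hb.inverts_sq_inv]; group
    calc r * (a * b) * r⁻¹ = r * a * r * ((r * r)⁻¹ * (r * b * r)) * (r * r)⁻¹ := by group
      _ = a⁻¹ * b⁻¹ := by rw [ha.mul_mul, hb.mul_mul, e]; group
      _ = (a * b)⁻¹ := by rw [hab.eq, mul_inv_rev]
  rcases h with h | h
  · rw [h.eq, mul_inv_cancel_right] at h1
    apply hsq
    nth_rw 1 [h1]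
    exact inv_mul_cancel _
  · have h2 := h.mul_mul
    rw [← h1] at h2
    apply hr
    have h3 := mul_left_cancel h2
    nth_rw 1 [h3]
    exact inv_mul_cancel _

theorem commute_all_of_span [Finite G] (hG : IsPGroup 2 G) (hsq : SqSpans G) {v : G}
    (h : ∀ r : G, r * r ≠ 1 → ¬ Commute v r →
      charVec r ∈ Submodule.span (ZMod 2) (charVec '' {w | Commute v w})) (g : G) :
    Commute v g := by
  have hcl : Subgroup.closure {w | Commute v w} = ⊤ := by
    refine closure_eq_top_of_charVec hG _ fun g => ?_
    by_contra hg
    obtain ⟨r, hr, hrW⟩ := hsq _ g hg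
    by_cases hvr : Commute v r
    · exact hrW (Submodule.subset_span ⟨r, hvr, rfl⟩)
    · exact hrW (h r hr hvr)
  have hg : g ∈ Subgroup.closure {w | Commute v w} := hcl ▸ Subgroup.mem_top g
  induction hg using Subgroup.closure_induction with
  | mem y hy => exact hy
  | one => exact Commute.one_right v
  | mul a b _ _ ha hb => exact ha.mul_right hb
  | inv a _ ha => exact ha.inv_right

/-- If independent non-involutions always commute or form an anti-pair, and some non-involution
is central, then the group is abelian. -/
theorem commute_all_of_central [Finite G] (hG : IsPGroup 2 G) (hsq : SqSpans G)
    (hca : ∀ r w : G, r * r ≠ 1 → w * w ≠ 1 → charVec r ≠ 0 → charVec w ≠ 0 →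
      charVec r ≠ charVec w → Commute r w ∨ AntiPair r w)
    {c : G} (hc : c * c ≠ 1) (hcen : ∀ g, Commute c g) (a b : G) : Commute a b := by
  have half : ∀ r r' : G, r * r ≠ 1 → r' * r' ≠ 1 →
      charVec r' ∉ Submodule.span (ZMod 2) {charVec c, charVec r} → charVec r ≠ charVec c →
      ¬ Commute r' r → AntiPair r' r → r * r = c * c ∧ c * c * (c * c) = 1 := by
    intro r r' nr nr' hi hrc hnc hanti
    rw [zmod_two_mem_span_pair, not_or, not_or, not_or] at hi
    -- If r d were a non-involution, r' would commute with it, hence with r, or be anti to it,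
    -- forcing d² = 1. Taking d = c and d = c⁻¹ yields r² = c² and c⁴ = 1.
    have key : ∀ d : G, (∀ g, Commute d g) → d * d ≠ 1 → charVec d = charVec c →
        r * d * (r * d) = 1 := by
      intro d hd nd ed
      by_contra hne
      have i1 : charVec (r * d) ≠ 0 := by
        rw [charVec_mul, ed]
        intro h
        rw [add_eq_zero_iff_eq_neg, zmod_two_neg] at h
        exact hrc h
      have i2 : charVec r' ≠ charVec (r * d) := by
        rw [charVec_mul, ed, add_comm]
        exact hi.2.2.2
      rcases hca r' (r * d) nr' hne hi.1 i1 i2 with h | h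
      · apply hnc
        have := h.mul_right (hd r').symm.inv_right
        simpa using this
      · have h1 := h.mul_mul
        have h2 : r' * (r * d) * r' = r⁻¹ * d := by
          rw [← hanti.mul_mul]
          simp only [mul_assoc, (hd r').eq]
        rw [h2, (hd r).symm.eq, mul_inv_rev] at h1
        exact nd (mul_eq_one_iff_eq_inv.mpr (mul_left_cancel h1))
    have k1 := key c hcen hc rfl
    have k2 := key c⁻¹ (fun g => (hcen g).inv_left)
      (by rw [← mul_inv_rev, inv_ne_one]; exact hc) (charVec_inv c)
    have e1 : r * r * (c * c) = 1 := by
      rw [← k1, mul_assoc r c, ← mul_assoc c r c, (hcen r).eq]; group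
    have e2 : r * r = c * c := by
      rw [← mul_inv_eq_one, ← k2, mul_assoc r c⁻¹, ← mul_assoc c⁻¹ r, ((hcen r).inv_left).eq]
      group
    exact ⟨e2, e2 ▸ e1⟩
  have hcentral : ∀ r : G, r * r ≠ 1 → charVec r ≠ 0 → charVec r ≠ charVec c →
      ∀ g, Commute r g := by
    intro r nr hr0 hrc
    refine commute_all_of_span hG hsq fun r' nr' hnc => ?_
    have hle : Submodule.span (ZMod 2) {charVec c, charVec r} ≤
        Submodule.span (ZMod 2) (charVec '' {w | Commute r w}) := by
      rw [Submodule.span_le]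
      rintro _ (rfl | rfl)
      · exact Submodule.subset_span ⟨c, (hcen r).symm, rfl⟩
      · exact Submodule.subset_span ⟨r, Commute.refl r, rfl⟩
    by_contra hout
    have hi : charVec r' ∉ Submodule.span (ZMod 2) {charVec c, charVec r} := fun h =>
      hout (hle h)
    have hi' := hi
    rw [zmod_two_mem_span_pair, not_or, not_or, not_or] at hi'
    have hi2 : charVec r ∉ Submodule.span (ZMod 2) {charVec c, charVec r'} := by
      rw [zmod_two_mem_span_pair, not_or, not_or, not_or]
      refine ⟨hr0, hrc, Ne.symm hi'.2.2.1, fun e => hi'.2.2.2 ?_⟩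
      rw [e, ← add_assoc, zmod_two_add_self, zero_add]
    have a1 : AntiPair r' r := (hca r' r nr' nr hi'.1 hr0 hi'.2.2.1).resolve_left
      fun h => hnc h.symm
    have a2 : AntiPair r r' := (hca r r' nr nr' hr0 hi'.1 (Ne.symm hi'.2.2.1)).resolve_left hnc
    obtain ⟨e1, e3⟩ := half r r' nr nr' hi hrc (fun h => hnc h.symm) a1
    obtain ⟨e2, -⟩ := half r' r nr' nr hi2 hi'.2.1 hnc a2
    apply hnc
    have h1 := a1.mul_mul
    have h2 : r' * r = r⁻¹ * r'⁻¹ := by rw [← h1, mul_inv_cancel_right]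
    have h3 : r⁻¹ * r'⁻¹ = r * (r * r)⁻¹ * (r' * r')⁻¹ * r' := by simp [mul_assoc]
    have e4 : (c * c)⁻¹ * (c * c)⁻¹ = 1 := by rw [← mul_inv_rev, e3, inv_one]
    rw [← h2, e1, e2, mul_assoc r, e4, mul_one] at h3
    exact h3.symm
  refine (commute_all_of_span hG hsq (v := a) (fun r nr hnr => ?_) b)
  have hc' : charVec c ∈ Submodule.span (ZMod 2) (charVec '' {w | Commute a w}) :=
    Submodule.subset_span ⟨c, (hcen a).symm, rfl⟩
  by_cases h0 : charVec r = 0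
  · rw [h0]; exact zero_mem _
  by_cases h1 : charVec r = charVec c
  · rw [h1]; exact hc'
  · exact absurd (hcentral r nr h0 h1 a).symm hnr

/-- If there is a path of length two, then there is a noncommuting one, unless the group is
abelian. -/
theorem exists_noncommuting_start [Finite G] (hG : IsPGroup 2 G) (hsq : SqSpans G)
    (hna : ∃ a b : G, ¬ Commute a b) {u v : G} (nu : u * u ≠ 1) (nv : v * v ≠ 1)
    (nuv : v * u⁻¹ * (v * u⁻¹) ≠ 1) (iu : charVec u ≠ 0) (iv : charVec v ≠ 0)
    (iuv : charVec v ≠ charVec u) :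
    ∃ x : ℕ → G, IsPath x 2 2 ∧ ¬ Commute (x 0) (x 1) := by
  by_contra hcon
  have hno : ∀ a b : G, a * a ≠ 1 → b * b ≠ 1 → b * a⁻¹ * (b * a⁻¹) ≠ 1 → charVec a ≠ 0 →
      charVec b ≠ 0 → charVec b ≠ charVec a → Commute a b := by
    intro a b h1 h2 h3 h4 h5 h6
    by_contra h7
    exact hcon ⟨_, isPath_seqThree_two 1 h1 h2 h3 h4 h5 h6, h7⟩
  have hca : ∀ r w : G, r * r ≠ 1 → w * w ≠ 1 → charVec r ≠ 0 → charVec w ≠ 0 →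
      charVec r ≠ charVec w → Commute r w ∨ AntiPair r w := by
    intro r w h1 h2 h3 h4 h5
    by_cases h6 : Commute r w
    · exact Or.inl h6
    right
    refine AntiPair.of_inv' ?_ ?_
    · by_contra h7
      exact h6 (hno w r h2 h1 h7 h4 h3 h5).symm
    · by_contra h7
      have := hno w r⁻¹ h2 (by rw [← mul_inv_rev, inv_ne_one]; exact h1) h7 h4 (by simpa using h3)
        (by simpa using h5)
      exact h6 (by simpa using this.symm)
  obtain ⟨a, b, hab⟩ := hna
  -- elements outside the span of an edge commute with its endpoints
  have step : ∀ u v : G, u * u ≠ 1 → v * v ≠ 1 → v * u⁻¹ * (v * u⁻¹) ≠ 1 → charVec u ≠ 0 →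
      charVec v ≠ 0 → charVec v ≠ charVec u → ∀ r, r * r ≠ 1 →
      charVec r ∉ Submodule.span (ZMod 2) {charVec u, charVec v} →
      Commute r u ∧ Commute r v := by
    intro u v nu nv nuv iu iv iuv r nr hr
    have huv := hno u v nu nv nuv iu iv iuv
    rw [zmod_two_mem_span_pair, not_or, not_or, not_or] at hr
    have hy0 : charVec (v * u⁻¹) ≠ 0 := by
      rw [charVec_mul, charVec_inv]
      intro h
      rw [add_eq_zero_iff_eq_neg, zmod_two_neg] at h
      exact iuv h
    have cu := hca r u nr nu hr.1 iu hr.2.1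
    have cv := hca r v nr nv hr.1 iv hr.2.2.1
    have cy := hca r (v * u⁻¹) nr nuv hr.1 hy0 (by
      rw [charVec_mul, charVec_inv, add_comm]; exact hr.2.2.2)
    have huy : Commute (v * u⁻¹) u := (huv.symm).mul_left (Commute.refl u).inv_left
    have hvy : Commute (v * u⁻¹)⁻¹ v :=
      ((Commute.refl v).mul_left huv.inv_left).inv_left
    have e1 : v * u⁻¹ * u = v := by group
    have e2 : (v * u⁻¹)⁻¹ * v = u := by group
    -- By `AntiPair.mul_right_false`, r is anti to at most one of u, v and v u⁻¹; it commutes with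
    -- the other two, hence with all three.
    rcases cu with cu | au
    · rcases cv with cv | av
      · exact ⟨cu, cv⟩
      · rcases cy with cy | ay
        · have := cy.mul_right cu
          rw [e1] at this
          exact ⟨cu, this⟩
        · exact (ay.inv_right.mul_right_false av hvy nr (by rw [e2]; exact nu)
            (by rw [e2]; exact Or.inl cu)).elim
    · rcases cv with cv | av
      · rcases cy with cy | ay
        · have := cy.inv_right.mul_right cv
          rw [e2] at this
          exact ⟨this, cv⟩
        · exact (ay.mul_right_false au huy nr (by rw [e1]; exact nv)
            (by rw [e1]; exact Or.inl cv)).elim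
      · exact (av.mul_right_false au.inv_right huv.symm.inv_right nr nuv cy).elim
  have huv := hno u v nu nv nuv iu iv iuv
  have hex : ∃ p, p * p ≠ 1 ∧ charVec p ∉ Submodule.span (ZMod 2) {charVec u, charVec v} := by
    by_contra hall
    apply hab
    have hall' : ∀ g : G, charVec g ∈ Submodule.span (ZMod 2) {charVec u, charVec v} := by
      intro g
      by_contra hg
      obtain ⟨r, hr, hrW⟩ := hsq _ g hg
      exact hall ⟨r, hr, hrW⟩
    have hgen : ∀ w, Commute w u → Commute w v → ∀ g, Commute w g := by
      intro w wu wv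
      refine commute_all_of_span hG hsq fun r _ _ => ?_
      refine Submodule.span_mono ?_ (hall' r)
      rintro _ (rfl | rfl)
      · exact ⟨u, wu, rfl⟩
      · exact ⟨v, wv, rfl⟩
    have hu := hgen u (Commute.refl u) huv
    have hv := hgen v huv.symm (Commute.refl v)
    exact hgen a (hu a).symm (hv a).symm b
  obtain ⟨p, np, hp⟩ := hex
  have central : ∀ u v : G, u * u ≠ 1 → v * v ≠ 1 → v * u⁻¹ * (v * u⁻¹) ≠ 1 → charVec u ≠ 0 →
      charVec v ≠ 0 → charVec v ≠ charVec u →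
      charVec p ∉ Submodule.span (ZMod 2) {charVec u, charVec v} → p * p ≠ v * v → False := by
    intro u v nu nv nuv iu iv iuv hp hpv
    obtain ⟨-, cpv⟩ := step u v nu nv nuv iu iv iuv p np hp
    have hp' := hp
    rw [zmod_two_mem_span_pair, not_or, not_or, not_or] at hp'
    have npv : p * v⁻¹ * (p * v⁻¹) ≠ 1 := by
      intro h
      apply hpv
      rw [← mul_inv_eq_one, ← h, mul_assoc p v⁻¹, ← mul_assoc v⁻¹ p, (cpv.symm.inv_left).eq]
      group
    refine hab (commute_all_of_central hG hsq hca nv (commute_all_of_span hG hsq ?_) a b)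
    intro r nr hnc
    have r1 : charVec r ∈ Submodule.span (ZMod 2) {charVec u, charVec v} := by
      by_contra h
      exact hnc (step u v nu nv nuv iu iv iuv r nr h).2.symm
    -- Since p commutes with v and p² ≠ v², the pair v, p is an edge too. A non-involution not
    -- commuting with v lies in both spans, which meet only in 0 and the vector of v; so v is
    -- central.
    have r2 : charVec r ∈ Submodule.span (ZMod 2) {charVec v, charVec p} := by
      by_contra h
      exact hnc (step v p nv np npv iv hp'.1 hp'.2.2.1 r nr h).1.symm
    have hv : charVec v ∈ Submodule.span (ZMod 2) (charVec '' {w | Commute v w}) :=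
      Submodule.subset_span ⟨v, Commute.refl v, rfl⟩
    have hvu : charVec v ∈ Submodule.span (ZMod 2) {charVec u, charVec v} :=
      Submodule.subset_span (by simp)
    rw [zmod_two_mem_span_pair] at r2
    rcases r2 with e | e | e | e
    · rw [e]; exact zero_mem _
    · rw [e]; exact hv
    · exact absurd (e ▸ r1) hp
    · rw [e, Submodule.add_mem_iff_right _ hvu] at r1
      exact absurd r1 hp
  have hne : u * u ≠ v * v := by
    intro h
    apply nuv
    rw [mul_assoc v u⁻¹, ← mul_assoc u⁻¹ v, huv.inv_left.eq, mul_assoc v u⁻¹, ← mul_assoc v v,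
      ← h]
    group
  -- As u² ≠ v², the square of p differs from at least one of them.
  by_cases hpv : p * p = v * v
  · refine central v u nv nu (sq_inv_ne nuv) iv iu iuv.symm (by rw [Set.pair_comm]; exact hp) ?_
    rw [hpv]; exact hne.symm
  · exact central u v nu nv nuv iu iv iuv hp hpv

end Start

/-! ### Consequences of no automorphism inverting more than half. -/

section MaximallyInverting

variable {M : Type*} [Group M]

/-- If no automorphism inverts more than half of the elements, then there is no abelian subgroup
of index at most two. -/
theorem false_of_abelian_index_le_two [Finite M]
    (hmax : ∀ α : M ≃* M, 2 * {n : M | α n = n⁻¹}.ncard ≤ Nat.card M) (B : Subgroup M)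
    (hB : ∀ a ∈ B, ∀ b ∈ B, Commute a b) (t : M) (ht : ∀ n, n ∈ B ∨ t⁻¹ * n ∈ B) : False := by
  classical
  have out : ∀ x, x ∉ B → ∃ b ∈ B, x = t * b := fun x hx =>
    ⟨t⁻¹ * x, (ht x).resolve_left hx, by group⟩
  have tbt : ∀ x, x ∉ B → ∀ b ∈ B, t * b * t ∈ B := by
    intro x hx b hb
    refine (ht _).resolve_right fun h => hx ?_
    have h1 : b * t ∈ B := by simpa [mul_assoc] using h
    have h2 : t ∈ B := (B.mul_mem_cancel_left hb).mp h1
    obtain ⟨c, hc, rfl⟩ := out x hx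
    exact B.mul_mem h2 hc
  have oo : ∀ x y, x ∉ B → y ∉ B → x * y ∈ B := by
    intro x y hx hy
    obtain ⟨b, hb, rfl⟩ := out x hx
    obtain ⟨c, hc, rfl⟩ := out y hy
    have := B.mul_mem (tbt _ hx b hb) hc
    simpa [mul_assoc] using this
  -- This automorphism inverts all of B and also t, which is one element too many when t ∉ B.
  let β : M →* M :=
    { toFun := fun x => if x ∈ B then x⁻¹ else t⁻¹ * x⁻¹ * t
      map_one' := by simp [B.one_mem]
      map_mul' := by
        intro x y
        by_cases hx : x ∈ B
        · by_cases hy : y ∈ B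
          · simp only [hx, hy, B.mul_mem hx hy, if_true]
            rw [(hB x hx y hy).eq, mul_inv_rev]
          · simp only [hx, hy, B.mul_mem_cancel_left hx, if_true, if_false]
            obtain ⟨c, hc, rfl⟩ := out y hy
            have htt : t * t ∈ B := by simpa using tbt _ hy 1 B.one_mem
            have e1 := (hB c⁻¹ (B.inv_mem hc) (t⁻¹ * x⁻¹ * t) ?_).eq
            · have e2 := (hB (t * t)⁻¹ (B.inv_mem htt) x⁻¹ (B.inv_mem hx)).eq
              calc t⁻¹ * (x * (t * c))⁻¹ * t = t⁻¹ * (c⁻¹ * (t⁻¹ * x⁻¹ * t)) := by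
                    simp [mul_assoc]
                _ = ((t * t)⁻¹ * x⁻¹) * t * c⁻¹ := by rw [e1]; simp [mul_assoc]
                _ = x⁻¹ * (t⁻¹ * (t * c)⁻¹ * t) := by
                  rw [e2]; simp [mul_assoc]
            · have := B.mul_mem (B.inv_mem (tbt _ hy x hx)) htt
              simpa [mul_assoc] using this
        · by_cases hy : y ∈ B
          · simp only [hx, hy, B.mul_mem_cancel_right hy, if_true, if_false]
            obtain ⟨c, hc, rfl⟩ := out x hx
            have e1 := (hB c⁻¹ (B.inv_mem hc) y⁻¹ (B.inv_mem hy)).eq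
            simp only [mul_inv_rev, mul_assoc, inv_mul_cancel, mul_one]
            rw [e1]
          · simp only [hx, hy, oo x y hx hy, if_true, if_false]
            obtain ⟨b, hb, rfl⟩ := out x hx
            obtain ⟨c, hc, rfl⟩ := out y hy
            have e1 := (hB c⁻¹ (B.inv_mem hc) (t * b * t)⁻¹ (B.inv_mem (tbt _ hx b hb))).eq
            simpa [mul_assoc] using e1 }
  have hβ1 : ∀ x ∈ B, β x = x⁻¹ := fun x hx => if_pos hx
  have hβ2 : ∀ x, x ∉ B → β x = t⁻¹ * x⁻¹ * t := fun x hx => if_neg hx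
  have hinj : Function.Injective β := by
    rw [injective_iff_map_eq_one]
    intro x hx
    by_cases h : x ∈ B
    · rw [hβ1 x h] at hx
      exact inv_eq_one.mp hx
    · rw [hβ2 x h] at hx
      have : x⁻¹ = 1 := by
        have h2 : x⁻¹ = t * (t⁻¹ * x⁻¹ * t) * t⁻¹ := by simp [mul_assoc]
        rw [h2, hx]; simp
      exact inv_eq_one.mp this
  have hm := hmax (MulEquiv.ofBijective β (Finite.injective_iff_bijective.mp hinj))
  have hsub : insert t (B : Set M) ⊆ {n | MulEquiv.ofBijective β
      (Finite.injective_iff_bijective.mp hinj) n = n⁻¹} := by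
    rintro x (rfl | hx)
    · by_cases h : x ∈ B
      · exact hβ1 x h
      · refine (hβ2 x h).trans ?_
        simp
    · exact hβ1 x hx
  have hc := Set.ncard_le_ncard hsub (Set.toFinite _)
  have hpos : 0 < Nat.card M := Nat.card_pos
  by_cases h : t ∈ B
  · have hall : insert t (B : Set M) = Set.univ := by
      rw [Set.eq_univ_iff_forall]
      intro n
      right
      rcases ht n with h1 | h1
      · exact h1
      · exact (B.mul_mem_cancel_left (B.inv_mem h)).mp h1
    rw [hall, Set.ncard_univ] at hc
    omega
  · rw [Set.ncard_insert_of_notMem h (Set.toFinite _)] at hc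
    have hun : (Set.univ : Set M) ⊆ (B : Set M) ∪ (fun b => t * b) '' (B : Set M) := by
      intro n _
      rcases ht n with h1 | h1
      · exact Or.inl h1
      · exact Or.inr ⟨_, h1, by simp⟩
    have h1 := Set.ncard_le_ncard hun (Set.toFinite _)
    have h2 := Set.ncard_union_le (B : Set M) ((fun b => t * b) '' (B : Set M))
    have h3 := Set.ncard_image_le (f := fun b => t * b) (Set.toFinite (B : Set M))
    rw [Set.ncard_univ] at h1
    omega

theorem exists_hom_ne_one_of_sq {z : M} (hz : ∀ g, Commute z g) (hzz : z * z = 1)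
    (hsq : ∀ x : M, x * x = 1 ∨ x * x = z) {n : M} (h1 : n ≠ 1) (h2 : n ≠ z) :
    ∃ f : M →* Multiplicative (ZMod 2), f n ≠ 1 := by
  obtain ⟨K, hK, hmem⟩ := exists_hom_ker_pair hz hzz
  have hQ : ∀ q : M ⧸ K, q * q = 1 := by
    intro q
    obtain ⟨x, rfl⟩ := QuotientGroup.mk_surjective q
    rw [← QuotientGroup.mk_mul, QuotientGroup.eq_one_iff]
    exact (hmem _).mpr (hsq x)
  let _ : CommGroup (M ⧸ K) :=
    { (inferInstance : Group (M ⧸ K)) with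
      mul_comm := fun a b => by
        have e : ∀ q : M ⧸ K, q⁻¹ = q := fun q => inv_eq_of_mul_eq_one_left (hQ q)
        rw [← e (a * b), mul_inv_rev, e, e] }
  let _ : Module (ZMod 2) (Additive (M ⧸ K)) :=
    AddCommGroup.zmodModule fun q => by
      rw [two_nsmul]; exact hQ q.toMul
  have hne : Additive.ofMul (n : M ⧸ K) ∉ (⊥ : Submodule (ZMod 2) (Additive (M ⧸ K))) := by
    rw [Submodule.mem_bot]
    intro h
    have h' : (n : M ⧸ K) = 1 := h
    rw [QuotientGroup.eq_one_iff, hmem] at h'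
    exact h'.elim h1 h2
  obtain ⟨φ, hφ, -⟩ := Submodule.exists_le_ker_of_notMem hne
  refine ⟨φ.toAddMonoidHom.toMultiplicativeRight.comp (QuotientGroup.mk' K), fun h => hφ ?_⟩
  exact h

/-- If no automorphism inverts more than half of the elements, then there are many squares. -/
theorem manySquares_of_inverting [Finite M]
    (hmax : ∀ α : M ≃* M, 2 * {n : M | α n = n⁻¹}.ncard ≤ Nat.card M) : ManySquares M := by
  classical
  intro z
  by_contra hcon
  have hsq : ∀ x : M, x * x = 1 ∨ x * x = z := by
    intro x
    by_contra h
    rw [not_or] at h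
    exact hcon ⟨x, h⟩
  have hpos : 0 < Nat.card M := Nat.card_pos
  have hex : ∃ a : M, a * a ≠ 1 := by
    by_contra h
    have h' : ∀ a : M, a * a = 1 := fun a => by_contra fun h1 => h ⟨a, h1⟩
    have hm := hmax (MulEquiv.refl M)
    have : {n : M | MulEquiv.refl M n = n⁻¹} = Set.univ := by
      rw [Set.eq_univ_iff_forall]
      exact fun n => eq_inv_of_mul_eq_one_left (h' n)
    rw [this, Set.ncard_univ] at hm
    omega
  obtain ⟨a, ha⟩ := hex
  have haz : a * a = z := (hsq a).resolve_left ha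
  have hz1 : z ≠ 1 := haz ▸ ha
  have hz : ∀ n, Commute z n := by
    intro n
    have e : n * a * n⁻¹ * (n * a * n⁻¹) = n * z * n⁻¹ := by rw [← haz]; simp [mul_assoc]
    have h := hsq (n * a * n⁻¹)
    rw [e] at h
    rcases h with h | h
    · rw [conj_eq_one_iff] at h; exact absurd h hz1
    · exact (mul_inv_eq_iff_eq_mul.mp h).symm
  have hzz : z * z = 1 := by
    refine (hsq z).resolve_right fun h => hz1 ?_
    simpa using h
  -- Each character f gives a homomorphism into the central subgroup {1, z}, and n ↦ n c_f(n)
  -- inverts n exactly when n² = c_f(n). Pairs (f, n) with this property are counted in two ways.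
  let c : (M →* Multiplicative (ZMod 2)) → M → M := fun f n => if f n = 1 then 1 else z
  have m2 : ∀ x y : Multiplicative (ZMod 2), x ≠ 1 → y ≠ 1 → x * y = 1 := by decide
  have fz : ∀ f : M →* Multiplicative (ZMod 2), f z = 1 := by
    intro f
    rw [← haz, map_mul]
    generalize f a = y
    revert y; decide
  have czz : ∀ f n, c f n * c f n = 1 := by
    intro f n
    simp only [c]
    split_ifs
    · simp
    · exact hzz
  have ccomm : ∀ f n m, Commute (c f n) m := by
    intro f n m
    simp only [c]
    split_ifs
    · exact Commute.one_left m
    · exact hz m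
  have cmul : ∀ f n m, c f (n * m) = c f n * c f m := by
    intro f n m
    simp only [c, map_mul]
    by_cases h1 : f n = 1
    · simp [h1]
    · by_cases h2 : f m = 1
      · simp [h1, h2]
      · simp [h1, h2, m2 _ _ h1 h2, hzz]
  have fc : ∀ (f : M →* Multiplicative (ZMod 2)) n, f (c f n) = 1 := by
    intro f n
    simp only [c]
    split_ifs
    · exact map_one f
    · exact fz f
  let β : (M →* Multiplicative (ZMod 2)) → (M ≃* M) := fun f =>
    { toFun := fun n => n * c f n
      invFun := fun n => n * c f n
      left_inv := fun n => by
        have e : c f (n * c f n) = c f n := by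
          rw [cmul]
          have : c f (c f n) = 1 := if_pos (fc f n)
          rw [this, mul_one]
        change n * c f n * c f (n * c f n) = n
        rw [e, mul_assoc, czz, mul_one]
      right_inv := fun n => by
        have e : c f (n * c f n) = c f n := by
          rw [cmul]
          have : c f (c f n) = 1 := if_pos (fc f n)
          rw [this, mul_one]
        change n * c f n * c f (n * c f n) = n
        rw [e, mul_assoc, czz, mul_one]
      map_mul' := fun n m => by
        rw [cmul, mul_assoc, mul_assoc, ← mul_assoc m, ← (ccomm f n m).eq, mul_assoc] }
  have inv_iff : ∀ f n, β f n = n⁻¹ ↔ n * n = c f n := by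
    intro f n
    change n * c f n = n⁻¹ ↔ _
    rw [eq_inv_iff_mul_eq_one, mul_assoc, (ccomm f n n).eq, ← mul_assoc, mul_eq_one_iff_eq_inv,
      inv_eq_of_mul_eq_one_left (czz f n)]
  have : Finite (M →* Multiplicative (ZMod 2)) :=
    Finite.of_injective (fun f => (f : M → Multiplicative (ZMod 2))) DFunLike.coe_injective
  have := Fintype.ofFinite M
  have := Fintype.ofFinite (M →* Multiplicative (ZMod 2))
  let D := M →* Multiplicative (ZMod 2)
  have hup : ∀ f : D, 2 * (Finset.univ.filter fun n => n * n = c f n).card ≤ Fintype.card M := by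
    intro f
    have h := hmax (β f)
    rw [Nat.card_eq_fintype_card] at h
    convert h using 2
    rw [← Set.ncard_coe_finset]
    congr 1
    ext n
    simp [inv_iff]
  have hlow : ∀ n : M, Fintype.card D ≤
      2 * (Finset.univ.filter fun f : D => n * n = c f n).card := by
    intro n
    by_cases hn : n = 1 ∨ n = z
    · have : (Finset.univ.filter fun f : D => n * n = c f n) = Finset.univ := by
        rw [Finset.filter_eq_self]
        intro f _
        rcases hn with rfl | rfl
        · simp [c]
        · simp [c, fz, hzz]
      rw [this, Finset.card_univ]
      omega
    · rw [not_or] at hn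
      obtain ⟨f₀, h0⟩ := exists_hom_ne_one_of_sq hz hzz hsq hn.1 hn.2
      -- Multiplying f by a character nontrivial at n switches c_f(n), so at least half of the
      -- characters succeed at n. At n = 1 all do, which makes the total too large.
      have hle : (Finset.univ.filter fun f : D => ¬ n * n = c f n).card ≤
          (Finset.univ.filter fun f : D => n * n = c f n).card := by
        refine Finset.card_le_card_of_injOn (fun f => f * f₀) ?_
          ((mul_left_injective f₀).injOn)
        intro f hf
        simp only [Finset.coe_filter, Finset.mem_univ, true_and, Set.mem_ofPred_eq] at hf ⊢
        have e : (f * f₀) n = f n * f₀ n := rfl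
        by_cases h1 : f n = 1
        · have : (f * f₀) n ≠ 1 := by rw [e, h1, one_mul]; exact h0
          simp only [c, this, h1, if_true, if_false] at hf ⊢
          exact (hsq n).resolve_left hf
        · have : (f * f₀) n = 1 := by rw [e, m2 _ _ h1 h0]
          simp only [c, this, h1, if_true, if_false] at hf ⊢
          exact (hsq n).resolve_right hf
      have := Finset.card_filter_add_card_filter_not (s := (Finset.univ : Finset D))
        (fun f : D => n * n = c f n)
      rw [Finset.card_univ] at this
      omega
  have hone : Fintype.card D < 2 * (Finset.univ.filter fun f : D => (1 : M) * 1 = c f 1).card := by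
    have : (Finset.univ.filter fun f : D => (1 : M) * 1 = c f 1) = Finset.univ := by
      rw [Finset.filter_eq_self]
      intro f _
      simp [c]
    rw [this, Finset.card_univ]
    have : 0 < Fintype.card D := Fintype.card_pos
    omega
  have hdouble := Finset.sum_card_bipartiteAbove_eq_sum_card_bipartiteBelow
    (s := (Finset.univ : Finset D)) (t := (Finset.univ : Finset M)) (fun f n => n * n = c f n)
  have s1 : ∑ f : D, 2 * (Finset.univ.filter fun n => n * n = c f n).card ≤
      Fintype.card D * Fintype.card M := by
    refine (Finset.sum_le_sum fun f _ => hup f).trans ?_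
    simp
  have s2 : Fintype.card M * Fintype.card D <
      ∑ n : M, 2 * (Finset.univ.filter fun f : D => n * n = c f n).card := by
    have := Finset.sum_lt_sum (s := (Finset.univ : Finset M)) (fun n _ => hlow n)
      ⟨1, Finset.mem_univ _, hone⟩
    simpa using this
  rw [← Finset.mul_sum] at s1 s2
  have hd : ∑ f : D, (Finset.univ.filter fun n => n * n = c f n).card =
      ∑ n : M, (Finset.univ.filter fun f : D => n * n = c f n).card := hdouble
  rw [hd, mul_comm (Fintype.card D)] at s1
  omega

end MaximallyInverting

/-! ### The structure forced by an involution inverting half of N. -/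

section HalfInverted

variable {G : Type*} [Group G]

/-- An involution `g` outside a subgroup `N` of index two, which inverts a subset `H` of `N` such
that `N` is the disjoint union of `H` and `n₀ H`, but has no abelian subgroup of index two. -/
structure InvertsHalf (N : Subgroup G) (g n₀ : G) : Prop where
  index : N.index = 2
  not_mem : g ∉ N
  sq : g * g = 1
  mem : n₀ ∈ N
  disj : ∀ h ∈ invertedBy N g, n₀ * h ∉ invertedBy N g
  cover : ∀ n ∈ N, n ∈ invertedBy N g ∨ n₀⁻¹ * n ∈ invertedBy N g
  no_abelian : ∀ B ≤ N, (∀ a ∈ B, ∀ b ∈ B, Commute a b) → ∀ t ∈ N,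
    ¬ ∀ n ∈ N, n ∈ B ∨ t⁻¹ * n ∈ B

theorem commute_of_mem_closure {X : Set G} {y : G} (h : ∀ x ∈ X, Commute x y) {a : G}
    (ha : a ∈ Subgroup.closure X) : Commute a y := by
  induction ha using Subgroup.closure_induction with
  | mem x hx => exact h x hx
  | one => exact Commute.one_left y
  | mul a b _ _ ha hb => exact ha.mul_left hb
  | inv a _ ha => exact ha.inv_left

namespace InvertsHalf

variable {N : Subgroup G} {g n₀ : G}

theorem ginv (h : InvertsHalf N g n₀) : g⁻¹ = g := inv_eq_of_mul_eq_one_left h.sq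

theorem mem_iff (h : InvertsHalf N g n₀) {n : G} :
    n ∈ invertedBy N g ↔ n ∈ N ∧ g * n * g = n⁻¹ := by
  rw [invertedBy, Set.mem_ofPred_eq, h.ginv]

theorem one_mem (h : InvertsHalf N g n₀) : (1 : G) ∈ invertedBy N g :=
  h.mem_iff.mpr ⟨N.one_mem, by simp [h.sq]⟩

theorem inv_mem (h : InvertsHalf N g n₀) {n : G} (hn : n ∈ invertedBy N g) :
    n⁻¹ ∈ invertedBy N g := by
  obtain ⟨h1, h2⟩ := h.mem_iff.mp hn
  refine h.mem_iff.mpr ⟨N.inv_mem h1, ?_⟩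
  calc g * n⁻¹ * g = (g * n * g)⁻¹ := by simp [mul_assoc, h.ginv]
    _ = n⁻¹⁻¹ := by rw [h2]

theorem mul_mem_iff (h : InvertsHalf N g n₀) {a b : G} (ha : a ∈ invertedBy N g)
    (hb : b ∈ invertedBy N g) : a * b ∈ invertedBy N g ↔ Commute a b := by
  obtain ⟨a1, a2⟩ := h.mem_iff.mp ha
  obtain ⟨b1, b2⟩ := h.mem_iff.mp hb
  have e : g * (a * b) * g = a⁻¹ * b⁻¹ := by
    rw [← a2, ← b2]
    simp only [mul_assoc]
    rw [← mul_assoc g g, h.sq, one_mul]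
  rw [h.mem_iff, e, ← mul_inv_rev, inv_inj]
  exact ⟨fun h => h.2.symm, fun h => ⟨N.mul_mem a1 b1, h.symm⟩⟩

theorem notMem (h : InvertsHalf N g n₀) {n : G} (hn : n ∈ N) : g * n ∉ N := fun h' =>
  h.not_mem ((N.mul_mem_cancel_right hn).mp h')

theorem conj_mem (h : InvertsHalf N g n₀) {n : G} (hn : n ∈ N) : g * n * g ∈ N := by
  rw [Subgroup.mul_mem_iff_of_index_two h.index]
  exact iff_of_false (h.notMem hn) h.not_mem

/-- The elements `g * n₀ * t` with `t` inverted by `g` are not involutions. -/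
theorem sq_ne (h : InvertsHalf N g n₀) {t : G} (ht : t ∈ invertedBy N g) :
    g * n₀ * t * (g * n₀ * t) ≠ 1 := by
  intro e
  apply h.disj t ht
  refine h.mem_iff.mpr ⟨N.mul_mem h.mem ht.1, eq_inv_of_mul_eq_one_left ?_⟩
  rw [← e]
  simp only [mul_assoc]

/-- If n₀ were not generated, the covering would make H equal to its closure; a product-closed H is
abelian, and it would have index at most two. -/
theorem closure (h : InvertsHalf N g n₀) : N ≤ Subgroup.closure (invertedBy N g) := by
  have h0 : n₀ ∈ Subgroup.closure (invertedBy N g) := by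
    by_contra hn
    have hsub : ∀ a ∈ Subgroup.closure (invertedBy N g), a ∈ invertedBy N g := by
      intro a ha
      have haN : a ∈ N := (Subgroup.closure_le N).mpr (fun x hx => hx.1) ha
      refine (h.cover a haN).resolve_right fun h1 => hn ?_
      have := (Subgroup.closure _).mul_mem ha
        ((Subgroup.closure _).inv_mem (Subgroup.subset_closure h1))
      simpa using this
    refine h.no_abelian (Subgroup.closure (invertedBy N g))
      ((Subgroup.closure_le N).mpr fun x hx => hx.1) ?_ n₀ h.mem ?_
    · intro a ha b hb
      exact (h.mul_mem_iff (hsub a ha) (hsub b hb)).mp (hsub _ (mul_mem ha hb))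
    · intro n hn
      exact (h.cover n hn).imp (fun h => Subgroup.subset_closure h)
        fun h => Subgroup.subset_closure h
  intro n hn
  rcases h.cover n hn with h1 | h1
  · exact Subgroup.subset_closure h1
  · exact (Subgroup.mul_mem_cancel_left _ ((Subgroup.closure _).inv_mem h0)).mp
      (Subgroup.subset_closure h1)

theorem closure_insert (h : InvertsHalf N g n₀) {K : Subgroup G}
    (hK : ∀ t ∈ invertedBy N g, t ∈ K) (hx : g * n₀ ∈ K) (a : G) : a ∈ K := by
  have hN : N ≤ K := h.closure.trans ((Subgroup.closure_le K).mpr hK)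
  have hgK : g ∈ K := (K.mul_mem_cancel_right (hN h.mem)).mp hx
  by_cases ha : a ∈ N
  · exact hN ha
  · have : g * a ∈ N := by
      rw [Subgroup.mul_mem_iff_of_index_two h.index]
      exact iff_of_false h.not_mem ha
    exact (K.mul_mem_cancel_left hgK).mp (hN this)

/-- All g n₀ t with t ∈ H are non-involutions, and together they generate G. -/
theorem sqSpans (h : InvertsHalf N g n₀) : SqSpans G := by
  intro W a ha
  by_contra hcon
  have hall : ∀ r : G, r * r ≠ 1 → charVec r ∈ W := fun r hr =>
    by_contra fun h' => hcon ⟨r, hr, h'⟩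
  have hx : charVec (g * n₀) ∈ W := by
    have := hall _ (h.sq_ne h.one_mem)
    rwa [mul_one] at this
  refine ha (h.closure_insert (K := charPreimage W) (fun t ht => ?_) hx a)
  have := hall _ (h.sq_ne ht)
  rw [charVec_mul, Submodule.add_mem_iff_right _ hx] at this
  exact this

theorem exists_not_commute (h : InvertsHalf N g n₀) : ∃ a b : G, ¬ Commute a b := by
  by_contra hcon
  refine h.no_abelian N le_rfl (fun a _ b _ => ?_) 1 N.one_mem fun n hn => Or.inl hn
  by_contra h'
  exact hcon ⟨a, b, h'⟩

theorem charVec_ne (h : InvertsHalf N g n₀) {n m : G} (hn : n ∈ N) (hm : m ∈ N) :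
    charVec (g * n) ≠ charVec m := by
  intro e
  have := (charOfIndexTwo_eq_zero_iff N h.index m).mpr hm
  rw [← e, charOfIndexTwo_eq_zero_iff] at this
  exact h.notMem hn this

/-- If the inverted elements have at most one nonzero character vector, then `N` has an abelian
subgroup of index two. -/
theorem false_of_span [Finite G] (h : InvertsHalf N g n₀) (hG : IsPGroup 2 G) {t : G}
    (ht : t ∈ invertedBy N g) (htt : charVec t ≠ 0 → t * t = 1)
    (hspan : ∀ r ∈ invertedBy N g, charVec r = 0 ∨ charVec r = charVec t) : False := by
  have hcv : ∀ X : Set G, (charVec (g * n₀) ∈ Submodule.span (ZMod 2) (charVec '' X)) →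
      (charVec t ∈ Submodule.span (ZMod 2) (charVec '' X)) → Subgroup.closure X = ⊤ := by
    intro X h1 h2
    refine closure_eq_top_of_charVec hG X fun a =>
      h.closure_insert (K := charPreimage (Submodule.span (ZMod 2) (charVec '' X)))
        (fun r hr => ?_) h1 a
    rw [mem_charPreimage]
    rcases hspan r hr with e | e
    · rw [e]; exact zero_mem _
    · rw [e]; exact h2
  by_cases ht0 : charVec t = 0
  · have hcl := hcv {g * n₀} (Submodule.subset_span ⟨_, rfl, rfl⟩) (by rw [ht0]; exact zero_mem _)
    obtain ⟨a, b, hab⟩ := h.exists_not_commute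
    have hx : ∀ a, Commute a (g * n₀) := fun a => commute_of_mem_closure (X := {g * n₀})
      (by rintro _ rfl; exact Commute.refl _) (hcl ▸ Subgroup.mem_top a)
    exact hab (commute_of_mem_closure (X := {g * n₀}) (by rintro _ rfl; exact (hx b).symm)
      (hcl ▸ Subgroup.mem_top a))
  have t2 := htt ht0
  have hcl := hcv {g * n₀, t} (Submodule.subset_span ⟨_, Or.inl rfl, rfl⟩)
    (Submodule.subset_span ⟨_, Or.inr rfl, rfl⟩)
  -- Because H and n₀ H are disjoint and cover N, left multiplication by n₀² preserves H, as does
  -- that by n₀⁻¹ (g n₀ g). Such multipliers lie in H and commute with H; (g n₀)² is their product.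
  have s1 : ∀ r ∈ invertedBy N g, n₀ * n₀ * r ∈ invertedBy N g := by
    intro r hr
    refine (h.cover _ (N.mul_mem (N.mul_mem h.mem h.mem) hr.1)).resolve_right fun h1 => ?_
    rw [mul_assoc, inv_mul_cancel_left] at h1
    exact h.disj r hr h1
  have c1 : Commute (n₀ * n₀) t :=
    (h.mul_mem_iff (by simpa using s1 1 h.one_mem) ht).mp (s1 t ht)
  have s2 : ∀ r ∈ invertedBy N g, n₀⁻¹ * (g * n₀ * g) * r ∈ invertedBy N g := by
    intro r hr
    have haN := h.conj_mem h.mem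
    rw [mul_assoc]
    refine (h.cover _ (N.mul_mem haN hr.1)).resolve_left fun h1 => ?_
    apply h.disj _ (h.inv_mem hr)
    have e : g * (g * n₀ * g * r) * g = n₀ * (g * r * g) := by
      simp only [← mul_assoc, h.sq, one_mul]
    rw [← (h.mem_iff.mp hr).2, ← e, (h.mem_iff.mp h1).2]
    exact h.inv_mem h1
  have c2 : ∀ n ∈ N, Commute n (n₀⁻¹ * (g * n₀ * g)) := fun n hn =>
    commute_of_mem_closure (fun r hr =>
      ((h.mul_mem_iff (by simpa using s2 1 h.one_mem) hr).mp (s2 r hr)).symm) (h.closure hn)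
  set x := g * n₀ with hx
  set u := x * x with hu
  have eu : u = n₀ * n₀ * (n₀⁻¹ * (x * g)) := by
    rw [mul_assoc n₀ n₀, (c2 n₀ h.mem).eq]
    simp [hu, hx, mul_assoc]
  have ut : Commute u t := by
    rw [eu]; exact c1.mul_left (c2 t ht.1).symm
  have ux : Commute u x := (Commute.refl x).mul_left (Commute.refl x)
  -- G is generated by x and t, while u = x² commutes with both. Since t² = 1, this abelian B
  -- satisfies G = B ∪ t B.
  set B := Subgroup.closure {x * t, u}
  have hmem1 : x * t ∈ B := Subgroup.subset_closure (Or.inl rfl)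
  have hmem2 : u ∈ B := Subgroup.subset_closure (Or.inr rfl)
  have hB : ∀ a ∈ B, ∀ b ∈ B, Commute a b := by
    intro a ha b hb
    refine commute_of_mem_closure (fun y hy => ?_) ha
    refine (commute_of_mem_closure (fun w hw => ?_) hb).symm
    rcases hy with rfl | rfl <;> rcases hw with rfl | rfl
    · exact Commute.refl _
    · exact ux.mul_right ut
    · exact (ux.mul_right ut).symm
    · exact Commute.refl _
  have tinv : t⁻¹ = t := inv_eq_of_mul_eq_one_left t2
  have htx : t * x = u * (x * t)⁻¹ := by
    have e : t * x * (x * t) = t * u * t := by simp only [hu, mul_assoc]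
    rw [eq_mul_inv_iff_mul_eq, e, ← ut.eq, mul_assoc, t2, mul_one]
  have hxt : ∀ b ∈ B, (x * b ∈ B ∨ t * (x * b) ∈ B) ∧ (x * (t * b) ∈ B ∨ t * (x * (t * b)) ∈ B) := by
    intro b hb
    refine ⟨Or.inr ?_, Or.inl ?_⟩
    · rw [← mul_assoc, htx]
      exact mul_mem (mul_mem hmem2 (B.inv_mem hmem1)) hb
    · rw [← mul_assoc]
      exact mul_mem hmem1 hb
  have hall : ∀ y : G, y ∈ B ∨ t * y ∈ B := by
    intro y
    have hy : y ∈ Subgroup.closure {x, t} := hcl ▸ Subgroup.mem_top y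
    have hxs : ∀ y, (y ∈ B ∨ t * y ∈ B) → (x * y ∈ B ∨ t * (x * y) ∈ B) := by
      rintro y (hb | hb)
      · exact (hxt y hb).1
      · have := (hxt _ hb).2
        rwa [← mul_assoc t t, t2, one_mul] at this
    have hts : ∀ y, (y ∈ B ∨ t * y ∈ B) → (t * y ∈ B ∨ t * (t * y) ∈ B) := by
      rintro y (hb | hb)
      · right; rwa [← mul_assoc t t, t2, one_mul]
      · exact Or.inl hb
    induction hy using Subgroup.closure_induction_left with
    | one => exact Or.inl B.one_mem
    | mul_left a ha y _ ih =>
      rcases ha with rfl | rfl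
      · exact hxs y ih
      · exact hts y ih
    | inv_mul_cancel a ha y _ ih =>
      rcases ha with rfl | rfl
      · have e : x⁻¹ * y = u⁻¹ * (x * y) := by rw [hu]; simp [mul_assoc]
        rw [e]
        refine (hxs y ih).imp (fun h1 => mul_mem (B.inv_mem hmem2) h1) fun h1 => ?_
        rw [← mul_assoc, ← ut.inv_left.eq, mul_assoc]
        exact mul_mem (B.inv_mem hmem2) h1
      · rw [tinv]; exact hts y ih
  refine h.no_abelian (B ⊓ N) inf_le_right (fun a ha b hb => hB a ha.1 b hb.1) t ht.1
    fun n hn => ?_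
  rw [tinv]
  exact (hall n).imp (fun h1 => ⟨h1, hn⟩) fun h1 => ⟨h1, N.mul_mem ht.1 hn⟩

/-- If independent quotients of inverted elements are involutions, then the inverted elements
commute, provided that their character vectors span a space of dimension at least two. -/
theorem commute_of_no_edge (h : InvertsHalf N g n₀)
    (h1 : ∀ t ∈ invertedBy N g, charVec t ≠ 0 → t * t = 1)
    (h2 : ∀ t ∈ invertedBy N g, ∀ s ∈ invertedBy N g, charVec t ≠ charVec s →
      t * s⁻¹ * (t * s⁻¹) = 1)
    (hr : ∀ t ∈ invertedBy N g, ∃ r ∈ invertedBy N g, charVec r ≠ 0 ∧ charVec r ≠ charVec t)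
    {t s : G} (ht : t ∈ invertedBy N g) (hs : s ∈ invertedBy N g) : Commute t s := by
  have inv : ∀ t ∈ invertedBy N g, charVec t ≠ 0 → t⁻¹ = t := fun t ht t0 =>
    inv_eq_of_mul_eq_one_left (h1 t ht t0)
  have a1 : ∀ t ∈ invertedBy N g, ∀ s ∈ invertedBy N g, charVec t ≠ 0 → charVec s ≠ 0 →
      charVec t ≠ charVec s → Commute t s := by
    intro t ht s hs t0 s0 hts
    have := eq_inv_of_mul_eq_one_left (h2 t ht s hs hts)
    rw [mul_inv_rev, inv_inv, inv t ht t0, inv s hs s0] at this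
    exact this
  have hsum : ∀ a b : G, charVec (a * b) = charVec a → charVec b = 0 := by
    intro a b e
    rwa [charVec_mul, add_eq_left] at e
  have hsum0 : ∀ a b : G, charVec (a * b) = 0 → charVec a = charVec b := by
    intro a b e
    rwa [charVec_mul, add_eq_zero_iff_eq_neg, zmod_two_neg] at e
  have cancel : ∀ a b c : G, Commute a b → Commute a (b * c) → Commute a c := by
    intro a b c e1 e2
    have := e1.inv_right.mul_right e2
    rwa [inv_mul_cancel_left] at this
  have a2 : ∀ t ∈ invertedBy N g, ∀ s ∈ invertedBy N g, charVec t ≠ 0 → charVec s ≠ 0 →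
      Commute t s := by
    intro t ht s hs t0 s0
    by_cases hts : charVec t = charVec s
    · obtain ⟨r, hr, r0, rt⟩ := hr t ht
      have crt := a1 r hr t ht r0 t0 rt
      have hrt := (h.mul_mem_iff hr ht).mpr crt
      refine (cancel s r t (a1 s hs r hr s0 r0 (by rw [← hts]; exact rt.symm))
        (a1 s hs _ hrt s0 (fun e => rt (hsum0 r t e)) ?_)).symm
      rw [← hts, charVec_mul]
      intro e
      exact r0 (by rwa [right_eq_add] at e)
    · exact a1 t ht s hs t0 s0 hts
  have a3 : ∀ t ∈ invertedBy N g, ∀ s ∈ invertedBy N g, charVec t ≠ 0 → charVec s = 0 →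
      Commute t s := by
    intro t ht s hs t0 s0
    have flip : ∀ w ∈ invertedBy N g, charVec w ≠ 0 → w * s * w = s⁻¹ := by
      intro w hw w0
      have := eq_inv_of_mul_eq_one_left (h2 w hw s hs (by rw [s0]; exact w0))
      rw [mul_inv_rev, inv_inv, inv w hw w0] at this
      rw [mul_assoc, ← this]
      nth_rw 1 [← inv w hw w0]
      exact inv_mul_cancel_left _ _
    obtain ⟨r, hr, r0, rt⟩ := hr t ht
    have crt := a1 r hr t ht r0 t0 rt
    have hrt := (h.mul_mem_iff hr ht).mpr crt
    have e1 := flip t ht t0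
    have e2 := flip r hr r0
    have e3 := flip _ hrt fun e => rt (hsum0 r t e)
    -- The elements t, r and r t all invert s, but two inversions compose to the identity.
    have e4 : s⁻¹ = s := by
      have e5 : (r * t) * s * (r * t) = r * (t * s * t) * r := by
        nth_rw 2 [crt.eq]; simp only [mul_assoc]
      have e6 : r * s⁻¹ * r = (r * s * r)⁻¹ := by
        simp only [mul_inv_rev, inv r hr r0, mul_assoc]
      rw [← e3, e5, e1, e6, e2, inv_inv]
    rw [e4, mul_assoc, ← eq_inv_mul_iff_mul_eq, inv t ht t0] at e1
    exact e1.symm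
  by_cases t0 : charVec t = 0
  · by_cases s0 : charVec s = 0
    · obtain ⟨r, hr, r0, -⟩ := hr 1 h.one_mem
      have crt := a3 r hr t ht r0 t0
      refine (cancel s r t (a3 r hr s hs r0 s0).symm
        (a3 _ ((h.mul_mem_iff hr ht).mpr crt) s hs ?_ s0).symm).symm
      rw [charVec_mul, t0, add_zero]
      exact r0
    · exact (a3 s hs t ht s0 t0).symm
  · by_cases s0 : charVec s = 0
    · exact a3 t ht s hs t0 s0
    · exact a2 t ht s hs t0 s0

theorem exists_edge [Finite G] (h : InvertsHalf N g n₀) (hG : IsPGroup 2 G) :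
    ∃ u v : G, u * u ≠ 1 ∧ v * v ≠ 1 ∧ v * u⁻¹ * (v * u⁻¹) ≠ 1 ∧ charVec u ≠ 0 ∧
      charVec v ≠ 0 ∧ charVec v ≠ charVec u := by
  by_contra hcon
  have hno : ∀ u v : G, u * u ≠ 1 → v * v ≠ 1 → v * u⁻¹ * (v * u⁻¹) ≠ 1 → charVec u ≠ 0 →
      charVec v ≠ 0 → charVec v = charVec u := fun u v h1 h2 h3 h4 h5 =>
    by_contra fun h6 => hcon ⟨u, v, h1, h2, h3, h4, h5, h6⟩
  have out : ∀ t ∈ invertedBy N g, ∀ m ∈ N, charVec (g * n₀ * t) ≠ charVec m := by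
    intro t ht m hm
    rw [mul_assoc]
    exact h.charVec_ne (N.mul_mem h.mem ht.1) hm
  have out0 : ∀ t ∈ invertedBy N g, charVec (g * n₀ * t) ≠ 0 := fun t ht => by
    rw [← charVec_one]; exact out t ht 1 N.one_mem
  have h1 : ∀ t ∈ invertedBy N g, charVec t ≠ 0 → t * t = 1 := by
    intro t ht t0
    by_contra hne
    -- The candidate edge is t⁻¹, g n₀, with quotient g n₀ t.
    refine out 1 h.one_mem t⁻¹ (N.inv_mem ht.1) (hno t⁻¹ _ ?_ (h.sq_ne h.one_mem) ?_ ?_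
      (out0 1 h.one_mem))
    · rw [← mul_inv_rev, inv_ne_one]; exact hne
    · rw [inv_inv, mul_one]; exact h.sq_ne ht
    · rw [charVec_inv]; exact t0
  have h2 : ∀ t ∈ invertedBy N g, ∀ s ∈ invertedBy N g, charVec t ≠ charVec s →
      t * s⁻¹ * (t * s⁻¹) = 1 := by
    intro t ht s hs hts
    by_contra hne
    apply hts
    -- The candidate edge is g n₀ s, g n₀ t, whose quotient is conjugate to t s⁻¹.
    have := hno _ _ (h.sq_ne hs) (h.sq_ne ht) ?_ (out0 s hs) (out0 t ht)
    · rwa [charVec_mul, charVec_mul _ s, add_right_inj] at this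
    · intro e
      apply hne
      have e2 : g * n₀ * t * (g * n₀ * s)⁻¹ * (g * n₀ * t * (g * n₀ * s)⁻¹) =
          g * n₀ * (t * s⁻¹ * (t * s⁻¹)) * (g * n₀)⁻¹ := by simp [mul_assoc]
      rwa [e2, conj_eq_one_iff] at e
  by_cases hB : ∃ t ∈ invertedBy N g, ∀ r ∈ invertedBy N g, charVec r = 0 ∨ charVec r = charVec t
  · obtain ⟨t, ht, hspan⟩ := hB
    exact h.false_of_span hG ht (h1 t ht) hspan
  · have hr : ∀ t ∈ invertedBy N g, ∃ r ∈ invertedBy N g,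
        charVec r ≠ 0 ∧ charVec r ≠ charVec t := by
      intro t ht
      by_contra hr
      refine hB ⟨t, ht, fun r hr' => ?_⟩
      by_contra hc
      rw [not_or] at hc
      exact hr ⟨r, hr', hc⟩
    let K : Subgroup G :=
      { carrier := invertedBy N g
        mul_mem' := fun ha hb => (h.mul_mem_iff ha hb).mpr (h.commute_of_no_edge h1 h2 hr ha hb)
        one_mem' := h.one_mem
        inv_mem' := fun ha => h.inv_mem ha }
    exact h.no_abelian K (fun a ha => ha.1)
      (fun a ha b hb => h.commute_of_no_edge h1 h2 hr ha hb) n₀ h.mem h.cover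

theorem admitsORR [Finite G] (h : InvertsHalf N g n₀) (hG : IsPGroup 2 G)
    (hmany : ManySquares G) : AdmitsORR G := by
  obtain ⟨u, v, nu, nv, nuv, iu, iv, iuv⟩ := h.exists_edge hG
  obtain ⟨x, hx, hc⟩ :=
    exists_noncommuting_start hG h.sqSpans h.exists_not_commute nu nv nuv iu iv iuv
  exact hx.admitsORR_of_start hc hG h.sqSpans hmany

end InvertsHalf

theorem ManySquares.of_subgroup {N : Subgroup G} (h : ManySquares N) : ManySquares G := by
  intro z
  by_cases hz : z ∈ N
  · obtain ⟨x, h1, h2⟩ := h ⟨z, hz⟩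
    exact ⟨x, fun e => h1 (Subtype.ext e), fun e => h2 (Subtype.ext e)⟩
  · obtain ⟨x, h1, -⟩ := h 1
    exact ⟨x, fun e => h1 (Subtype.ext e), fun e => hz (e ▸ N.mul_mem x.2 x.2)⟩

theorem IsPGroup.of_index_two {N : Subgroup G} (hN : N.index = 2) (h : IsPGroup 2 N) :
    IsPGroup 2 G := by
  intro x
  obtain ⟨k, hk⟩ := h ⟨x * x, Subgroup.mul_self_mem_of_index_two hN x⟩
  refine ⟨k + 1, ?_⟩
  have := congrArg Subtype.val hk
  rw [pow_succ', pow_mul, pow_two]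
  exact this

end HalfInverted

/-! ### The main theorem. -/

theorem proposition5p1 {G : Type*} [Group G] [Finite G]
    (N : Subgroup G) (g n₀ : G)
    (hN_normal : N.Normal)
    (hN_index : N.index = 2)
    (hN_two : IsPGroup 2 N)
    (hgen : Subgroup.closure ((N : Set G) ∪ {g}) = ⊤)
    (hg : g ^ 2 = 1)
    (hn₀ : n₀ ∈ N)
    -- conjugation by `g` inverts precisely half of the elements of `N`
    (hhalf : 2 * (invertedBy N g).ncard = Nat.card N)
    -- `N = H ∪ n₀ H`
    (hcover : (N : Set G) = invertedBy N g ∪ n₀ • invertedBy N g)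
    -- no automorphism of `N` inverts more than half of the elements of `N`
    (hmax : ∀ α : N ≃* N, 2 * {n : N | α n = n⁻¹}.ncard ≤ Nat.card N) :
    AdmitsORR G ∨
      ∃ A : Subgroup N, IsMulCommutative A ∧ A.index = 4 ∧
        ((∃ ℓ : ℕ, ℓ ≤ 5 ∧ Nonempty (A ≃* C4TimesC2Pow ℓ)) ∨
          (∃ r : ℕ, r ≤ 7 ∧ Nonempty (A ≃* C2Pow r))) := by
  -- The construction yields an ORR in every case, so the exceptional alternative is never needed.
  left
  have hgN : g ∉ N := by
    intro h
    have : N = ⊤ := by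
      rw [eq_top_iff, ← hgen, Subgroup.closure_le]
      rintro x (hx | rfl)
      · exact hx
      · exact h
    rw [this, Subgroup.index_top] at hN_index
    omega
  -- Two sets of size |N|/2 that cover N must be disjoint.
  have hinter : invertedBy N g ∩ n₀ • invertedBy N g = ∅ := by
    have h1 := Set.ncard_union_add_ncard_inter (invertedBy N g) (n₀ • invertedBy N g)
      (Set.toFinite _) (Set.toFinite _)
    have h2 : (n₀ • invertedBy N g).ncard = (invertedBy N g).ncard :=
      Set.ncard_smul_set n₀ _
    have h3 : (N : Set G).ncard = Nat.card N := rfl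
    rw [← hcover, h2, h3] at h1
    rw [← Set.ncard_eq_zero (Set.toFinite _)]
    omega
  have hI : InvertsHalf N g n₀ :=
    { index := hN_index
      not_mem := hgN
      sq := by rw [← pow_two]; exact hg
      mem := hn₀
      disj := fun h hh h1 => by
        have : n₀ * h ∈ invertedBy N g ∩ n₀ • invertedBy N g :=
          ⟨h1, Set.smul_mem_smul_set hh⟩
        rw [hinter] at this
        exact this
      cover := fun n hn => by
        have : n ∈ (N : Set G) := hn
        rw [hcover] at this
        refine this.imp id fun h => ?_
        rwa [Set.mem_smul_set_iff_inv_smul_mem] at h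
      no_abelian := fun B _ hB t ht hall =>
        false_of_abelian_index_le_two hmax (B.subgroupOf N)
          (fun a ha b hb => Subtype.ext (hB a ha b hb).eq) ⟨t, ht⟩ fun n => hall n n.2 }
  exact hI.admitsORR (IsPGroup.of_index_two hN_index hN_two)
    (manySquares_of_inverting hmax).of_subgroup
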